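/- Let $a>0$, and let $\mathcal R^+$ and $\mathcal R^-$ be independent Poisson point processes on $\mathbb R_+\times(0,\infty)$ and $\mathbb R_+\times(-\infty,0)$, defined on a common probability space, with intensity measures $ds\times d\nu^+(x)$ and $ds\times d\nu^-(x)$, where $d\nu^\pm(x)=\frac32\,a\,|x|^{-5/2}dx$. For $c>0$ and $\theta\ge 0$ put $$V_c(\theta)=\int_0^\theta\!\int_{c}^{\infty}x\,\mathcal R^+(ds,dx)+\int_0^\theta\!\int_{-\infty}^{-c}x\,\mathcal R^-(ds,dx),$$ and let $$V(\theta)=\int_0^\theta\!\int_0^\infty x\,\mathcal R^+(ds,dx)+\int_0^\theta\!\int_{-\infty}^0 x\,\mathcal R^-(ds,dx),$$ where the integrals are understood as improper at $x=0$ with symmetric cut-off, i.e. $V(\theta)=\lim_{c\downarrow0}V_c(\theta)$ pathwise. Then: 1. $V$ is well defined: almost surely, for all $c>0$ and $\theta\ge0$ the integrals defining $V_c(\theta)$ are finite sums, and for all $\theta\ge 0$ the limit $\lim_{c\downarrow 0}V_c(\theta)$ exists in $\mathbb R$. 2. $V$ is a symmetric Lévy process (almost surely $V(0)=0$ and the paths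 are càdlàg, the increments are stationary and independent, and $-V$ has the same finite-dimensional distributions as $V$), and it is stable of index $3/2$: it is non-degenerate and for every $b>0$ the processes $(V(b\theta))_{\theta\ge0}$ and $(b^{2/3}V(\theta))_{\theta\ge0}$ have the same finite-dimensional distributions. Its characteristic exponent is $\Psi(\lambda)=C_0|\lambda|^{3/2}$, that is, $$\mathbb E\big[e^{i\lambda V(\theta)}\big]=e^{-\theta C_0|\lambda|^{3/2}}\qquad(\theta\ge0,\ \lambda\in\mathbb R),\qquad C_0=\frac32\,a\int_{\mathbb R}|y|^{-5/2}(1-\cos y)\,dy\in(0,\infty).$$ 3. Almost surely, $V_c\to V$ as $c\downarrow0$, uniformly on compact time intervals. -/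

import Mathlib

open MeasureTheory ProbabilityTheory Filter Topology Set
open scoped NNReal ENNReal

namespace PoissonStable

noncomputable section

/-- `R` is a Poisson point process (Poisson random measure) on `α` with intensity measure `Λ`:
a random `ℕ ∪ {∞}`-valued measure such that `R(B)` is Poisson with parameter `Λ(B)` for every
measurable `B` (with the usual convention that the Poisson law of infinite parameter is the
point mass at `∞`), and such that `R(B₁), …, R(Bₙ)` are independent for pairwise disjoint
measurable `B₁, …, Bₙ`. -/
structure IsPoissonPointProcess {Ω α : Type*} [MeasurableSpace Ω] [MeasurableSpace α]
    (R : Ω → Measure α) (Λ : Measure α) (P : Measure Ω) : Prop where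
  measurable : Measurable R
  integer_valued : ∀ ω, ∀ B, MeasurableSet B → R ω B = ∞ ∨ ∃ n : ℕ, R ω B = (n : ℝ≥0∞)
  hasLaw : ∀ B, MeasurableSet B → Λ B ≠ ∞ →
    HasLaw (fun ω => R ω B)
      ((poissonMeasure (Λ B).toNNReal).map (fun n : ℕ => (n : ℝ≥0∞))) P
  ae_eq_top : ∀ B, MeasurableSet B → Λ B = ∞ → ∀ᵐ ω ∂P, R ω B = ∞
  indep : ∀ (n : ℕ) (B : Fin n → Set α), (∀ i, MeasurableSet (B i)) →
    Pairwise (fun i j => Disjoint (B i) (B j)) → iIndepFun (fun i ω => R ω (B i)) P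

/-- The measure `(3/2) a |x|^{-5/2} dx` on the positive half-line `(0, ∞)`. -/
def nuPlus (a : ℝ) : Measure ℝ :=
  (volume.restrict (Ioi 0)).withDensity
    (fun x => ENNReal.ofReal (3 / 2 * a * |x| ^ (-(5 / 2) : ℝ)))

/-- The measure `(3/2) a |x|^{-5/2} dx` on the negative half-line `(-∞, 0)`. -/
def nuMinus (a : ℝ) : Measure ℝ :=
  (volume.restrict (Iio 0)).withDensity
    (fun x => ENNReal.ofReal (3 / 2 * a * |x| ^ (-(5 / 2) : ℝ)))

/-- The measure `ds × dν(x)` on (time in `[0, ∞)`) × (space). -/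
def timeIntensity (ν : Measure ℝ) : Measure (ℝ × ℝ) :=
  (volume.restrict (Ici 0)).prod ν

variable {Ω : Type*}

/-- The truncated process
`V_c(θ) = ∫_{[0,θ]×(c,∞)} x R⁺(ds,dx) + ∫_{[0,θ]×(-∞,-c)} x R⁻(ds,dx)`. -/
def truncV (Rp Rm : Ω → Measure (ℝ × ℝ)) (c : ℝ) (θ : ℝ≥0) (ω : Ω) : ℝ :=
  (∫ p in Icc (0 : ℝ) θ ×ˢ Ioi c, p.2 ∂(Rp ω)) +
    ∫ p in Icc (0 : ℝ) θ ×ˢ Iio (-c), p.2 ∂(Rm ω)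

/-- The process `V(θ) = ∫_0^θ ∫_0^∞ x R⁺(ds,dx) + ∫_0^θ ∫_{-∞}^0 x R⁻(ds,dx)`.  The integrals
are improper at `x = 0` (neither of the two converges absolutely there), and their sum is the
limit obtained by removing the jumps of size at most `c` symmetrically and letting `c ↓ 0`. -/
def V (Rp Rm : Ω → Measure (ℝ × ℝ)) (θ : ℝ≥0) (ω : Ω) : ℝ :=
  limUnder (𝓝[>] (0 : ℝ)) (fun c => truncV Rp Rm c θ ω)

/-- Right-continuous with left limits. -/
def IsCadlag (f : ℝ≥0 → ℝ) : Prop :=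
  ∀ t, ContinuousWithinAt f (Ici t) t ∧ ∃ l, Tendsto f (𝓝[<] t) (𝓝 l)

/-- Real-valued Lévy processes. -/
structure IsLevyProcess [MeasurableSpace Ω] (X : ℝ≥0 → Ω → ℝ) (P : Measure Ω) : Prop where
  aemeasurable : ∀ t, AEMeasurable (X t) P
  zero : ∀ᵐ ω ∂P, X 0 ω = 0
  indep_increments : HasIndepIncrements X P
  stationary_increments : ∀ s t : ℝ≥0,
    IdentDistrib (fun ω => X (s + t) ω - X s ω) (X t) P P
  cadlag : ∀ᵐ ω ∂P, IsCadlag (fun t => X t ω)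

/-- The processes `X` and `-X` have the same finite-dimensional distributions. -/
def IsSymmetricProcess [MeasurableSpace Ω] (X : ℝ≥0 → Ω → ℝ) (P : Measure Ω) : Prop :=
  ∀ I : Finset ℝ≥0, IdentDistrib (fun ω (i : I) => X i ω) (fun ω (i : I) => -X i ω) P P

/-- (Strict) stability of index `α`: for each `b > 0` the processes `(X_{bt})_t` and
`(b^{1/α} X_t)_t` have the same finite-dimensional distributions; trivial (deterministic)
processes are excluded. -/
structure IsStableProcess [MeasurableSpace Ω] (α : ℝ) (X : ℝ≥0 → Ω → ℝ) (P : Measure Ω) :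
    Prop where
  index_pos : 0 < α
  scaling : ∀ b : ℝ≥0, 0 < b → ∀ I : Finset ℝ≥0,
    IdentDistrib (fun ω (i : I) => X (b * i) ω)
      (fun ω (i : I) => (b : ℝ) ^ (1 / α) * X i ω) P P
  nondegenerate : ∃ t, ∀ x : ℝ, ¬ (X t =ᵐ[P] fun _ => x)

/-- `Ψ` is the characteristic exponent of `X`: `E[exp(i l X_t)] = exp(-t Ψ(l))`. -/
def HasCharExponent [MeasurableSpace Ω] (X : ℝ≥0 → Ω → ℝ) (Ψ : ℝ → ℂ) (P : Measure Ω) : Prop :=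
  ∀ (t : ℝ≥0) (l : ℝ),
    ∫ ω, Complex.exp (Complex.I * (l : ℂ) * (X t ω : ℂ)) ∂P = Complex.exp (-((t : ℝ) : ℂ) * Ψ l)

/-- `C₀ = (3/2) a ∫_ℝ |y|^{-5/2} (1 - cos y) dy`. -/
def C₀ (a : ℝ) : ℝ := 3 / 2 * a * ∫ y : ℝ, |y| ^ (-(5 / 2) : ℝ) * (1 - Real.cos y)

end

end PoissonStable

/-! Superpose the two point processes. The sum `Rp + Rm` has intensity `ds × jumpMeasure a`,
symmetric in the jump size, and `V_c(θ)` is the sum of its jumps of modulus above `c` up to time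
`θ`. Besides path regularity, the probabilistic input is the exponential functional `E exp(∫ g dR) =
exp ∫ (exp g - 1) dΛ` for bounded complex `g` supported in a set of finite intensity
(`HasPoissonLaplace.integral_cexp`). Real `g` gives Chernoff bounds, imaginary `g` gives
characteristic functions.

Convergence: the small jumps are not absolutely summable, but in the exponent of a signed sum over a
symmetric shell the linear term cancels, and the quadratic one is small. Put `N = 2^m`. Between the
cut-offs `(2N)^(-8)` and `N^(-8)` the sums are examined on a grid of about `N^6` times and `N^6`
jump sizes. The quadratic bound controls signed sums at grid points; sums of `|x|` over a thin time
slab and a thin shell control the oscillation inside a cell. Each failure has probability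
`O(exp(-N))`, so the union bound and Borel–Cantelli give a Cauchy property uniform in `θ` and in
real `c` (`HasPoissonLaplace.ae_uniformCauchy`). Uniform limits of càdlàg paths are càdlàg.

Law: `∑ l_j V(t_j)` is a limit of integrals of `h(s) x` over shells, with `h = ∑ l_j 1_[0,t_j]`. Its
characteristic function at one is therefore `exp(-C₀ ∫ |h|^(3/2) ds)`
(`HasPoissonLaplace.charFunctional`). The rest is read off this formula: independence of increments
because `|h|^(3/2)` is additive over disjoint supports, symmetry because `|-h| = |h|`, scaling by a
change of variable in `s`. -/

namespace PoissonStable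

/-! ### Exponential functional on simple functions, and superposition. -/

section Laplace

variable {Ω α : Type*} [MeasurableSpace Ω] [MeasurableSpace α] {P : Measure Ω}
  {R : Ω → Measure α} {Λ : Measure α}

lemma integral_cexp_poissonMeasure (r : ℝ≥0) (z : ℂ) :
    ∫ n : ℕ, Complex.exp (n * z) ∂(poissonMeasure r) =
      Complex.exp (r * (Complex.exp z - 1)) := by
  rw [integral_poissonMeasure]
  have h1 : ∀ n : ℕ, (Real.exp (-r) * r ^ n / n.factorial : ℝ) • Complex.exp (n * z) =
      Complex.exp (-r) * ((r * Complex.exp z) ^ n / n.factorial) := by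
    intro n
    rw [Complex.exp_nat_mul, Complex.real_smul]
    push_cast
    rw [mul_pow]
    ring
  simp_rw [h1]
  rw [tsum_mul_left, ← congrFun (NormedSpace.exp_eq_tsum_div (𝔸 := ℂ)) (r * Complex.exp z),
    ← Complex.exp_eq_exp_ℂ, ← Complex.exp_add]
  congr 1
  ring

lemma IsPoissonPointProcess.integral_cexp_real (hR : IsPoissonPointProcess R Λ P)
    {B : Set α} (hB : MeasurableSet B) (hΛ : Λ B ≠ ∞) (z : ℂ) :
    ∫ ω, Complex.exp ((R ω).real B * z) ∂P = Complex.exp (Λ.real B * (Complex.exp z - 1)) := by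
  have hm : Measurable fun u : ℝ≥0∞ => Complex.exp (u.toReal * z) := by fun_prop
  have h := (hR.hasLaw B hB hΛ).integral_comp (f := fun u : ℝ≥0∞ => Complex.exp (u.toReal * z))
    hm.aestronglyMeasurable
  rw [integral_map (by fun_prop) hm.aestronglyMeasurable] at h
  simpa [Function.comp_def, integral_cexp_poissonMeasure] using! h

lemma IsPoissonPointProcess.ae_ne_top (hR : IsPoissonPointProcess R Λ P)
    {B : Set α} (hB : MeasurableSet B) (hΛ : Λ B ≠ ∞) : ∀ᵐ ω ∂P, R ω B ≠ ∞ := by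
  have hm : MeasurableSet {u : ℝ≥0∞ | u ≠ ∞} := (measurableSet_singleton ∞).compl
  rw [(hR.hasLaw B hB hΛ).ae_iff (p := fun u => u ≠ ∞) (measurableSet_setOfPred.1 hm),
    ae_map_iff (by fun_prop) hm]
  simp

/-- `R` has the Laplace functional of a Poisson point process of intensity `Λ` on simple
functions. -/
structure HasPoissonLaplace (R : Ω → Measure α) (Λ : Measure α) (P : Measure Ω) : Prop where
  measurable : Measurable R
  ae_ne_top : ∀ B, MeasurableSet B → Λ B ≠ ∞ → ∀ᵐ ω ∂P, R ω B ≠ ∞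
  integral_cexp_simpleFunc : ∀ f : SimpleFunc α ℂ, Λ (Function.support f) ≠ ∞ →
    ∫ ω, Complex.exp (f.integral (R ω)) ∂P =
      Complex.exp (∑ z ∈ f.range, Λ.real (f ⁻¹' {z}) * (Complex.exp z - 1))

lemma simpleFunc_measure_fiber_ne_top (f : SimpleFunc α ℂ) (hf : Λ (Function.support f) ≠ ∞)
    {z : ℂ} (hz : z ≠ 0) : Λ (f ⁻¹' {z}) ≠ ∞ := by
  refine ne_top_of_le_ne_top hf (measure_mono fun x hx => ?_)
  simp only [mem_preimage, mem_singleton_iff] at hx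
  simp [hx, hz]

/-- The fibres of a simple function are disjoint, so the counts on them are independent and the
transform factorises into Poisson transforms. -/
lemma IsPoissonPointProcess.hasPoissonLaplace (hR : IsPoissonPointProcess R Λ P) :
    HasPoissonLaplace R Λ P where
  measurable := hR.measurable
  ae_ne_top B hB hΛ := hR.ae_ne_top hB hΛ
  integral_cexp_simpleFunc f hf := by
    classical
    have hprod : ∀ ω, Complex.exp (f.integral (R ω)) =
        ∏ i, Complex.exp ((R ω (f ⁻¹' {(f.range.equivFin.symm i : ℂ)})).toReal *
          (f.range.equivFin.symm i : ℂ)) := by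
      intro ω
      rw [← Complex.exp_sum, SimpleFunc.integral_eq,
        Equiv.sum_comp f.range.equivFin.symm
          (fun z : f.range => (((R ω (f ⁻¹' {(z : ℂ)})).toReal : ℂ) * (z : ℂ))),
        Finset.sum_coe_sort f.range (fun z => (((R ω (f ⁻¹' {z})).toReal : ℂ) * z))]
      simp [Measure.real]
    simp_rw [hprod]
    have hind := hR.indep _ (fun i => f ⁻¹' {(f.range.equivFin.symm i : ℂ)})
      (fun i => f.measurableSet_preimage _) (by
        intro i j hij
        refine Disjoint.preimage _ ?_
        rw [disjoint_singleton]
        intro h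
        exact hij (f.range.equivFin.symm.injective (Subtype.ext h)))
    rw [hind.integral_fun_prod_comp
      (f := fun i (u : ℝ≥0∞) => Complex.exp (u.toReal * (f.range.equivFin.symm i : ℂ)))
      (fun i => ((Measure.measurable_coe (f.measurableSet_preimage _)).comp
        hR.measurable).aemeasurable)
      (fun i => by
        have : Measurable fun u : ℝ≥0∞ =>
          Complex.exp (u.toReal * (f.range.equivFin.symm i : ℂ)) := by fun_prop
        exact this.aestronglyMeasurable),
      Equiv.prod_comp f.range.equivFin.symm (fun z : f.range =>
        ∫ ω, Complex.exp ((R ω (f ⁻¹' {(z : ℂ)})).toReal * (z : ℂ)) ∂P),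
      Finset.prod_coe_sort f.range (fun z : ℂ =>
        ∫ ω, Complex.exp ((R ω (f ⁻¹' {z})).toReal * z) ∂P), Complex.exp_sum]
    refine Finset.prod_congr rfl fun z _ => ?_
    have := hind.isProbabilityMeasure
    -- The fibre over `0` may have infinite intensity; its factor is `1` on both sides.
    by_cases hz : z = 0
    · simp [hz]
    · exact hR.integral_cexp_real (f.measurableSet_preimage _)
        (simpleFunc_measure_fiber_ne_top f hf hz) z

lemma simpleFunc_integral_add (f : SimpleFunc α ℂ) {μ ν : Measure α}
    (hμ : μ (Function.support f) ≠ ∞) (hν : ν (Function.support f) ≠ ∞) :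
    f.integral (μ + ν) = f.integral μ + f.integral ν := by
  simp only [SimpleFunc.integral_eq, ← Finset.sum_add_distrib]
  refine Finset.sum_congr rfl fun z _ => ?_
  by_cases hz : z = 0
  · simp [hz]
  · rw [measureReal_add_apply (simpleFunc_measure_fiber_ne_top f hμ hz)
      (simpleFunc_measure_fiber_ne_top f hν hz), add_smul]

/-- Independence multiplies the transforms and the exponents add. This suffices for the
superposition: that the sum is again a Poisson point process never has to be shown. -/
lemma HasPoissonLaplace.add {R' : Ω → Measure α} {Λ' : Measure α}
    (h : HasPoissonLaplace R Λ P) (h' : HasPoissonLaplace R' Λ' P) (hind : IndepFun R R' P) :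
    HasPoissonLaplace (fun ω => R ω + R' ω) (Λ + Λ') P where
  measurable := by
    have h1 := h.measurable
    have h2 := h'.measurable
    exact h1.add h2
  ae_ne_top B hB hΛ := by
    rw [Measure.add_apply] at hΛ
    filter_upwards [h.ae_ne_top B hB (fun h => hΛ (by simp [h])),
      h'.ae_ne_top B hB (fun h => hΛ (by simp [h]))] with ω h1 h2
    simp [h1, h2]
  integral_cexp_simpleFunc f hf := by
    rw [Measure.add_apply] at hf
    have hf1 : Λ (Function.support f) ≠ ∞ := fun h => hf (by simp [h])
    have hf2 : Λ' (Function.support f) ≠ ∞ := fun h => hf (by simp [h])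
    have hm : Measurable fun μ : Measure α => Complex.exp (f.integral μ) := by
      simp only [SimpleFunc.integral_eq, Complex.real_smul, Measure.real]
      have : ∀ z, Measurable fun μ : Measure α => μ (f ⁻¹' {z}) := fun z =>
        Measure.measurable_coe (f.measurableSet_preimage _)
      refine Complex.measurable_exp.comp (Finset.measurable_sum _ fun z _ => ?_)
      exact (Complex.measurable_ofReal.comp (this z).ennreal_toReal).mul_const z
    have hsupp : MeasurableSet (Function.support f) := f.measurableSet_support
    calc ∫ ω, Complex.exp (f.integral (R ω + R' ω)) ∂P
        = ∫ ω, Complex.exp (f.integral (R ω)) * Complex.exp (f.integral (R' ω)) ∂P := by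
          refine integral_congr_ae ?_
          filter_upwards [h.ae_ne_top _ hsupp hf1, h'.ae_ne_top _ hsupp hf2] with ω h1 h2
          rw [simpleFunc_integral_add f h1 h2, Complex.exp_add]
      _ = _ := by
          rw [hind.integral_fun_comp_mul_comp h.measurable.aemeasurable h'.measurable.aemeasurable
            hm.aestronglyMeasurable hm.aestronglyMeasurable, h.integral_cexp_simpleFunc f hf1,
            h'.integral_cexp_simpleFunc f hf2, ← Complex.exp_add, ← Finset.sum_add_distrib]
          congr 1
          refine Finset.sum_congr rfl fun z _ => ?_
          by_cases hz : z = 0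
          · simp [hz]
          · rw [measureReal_add_apply (simpleFunc_measure_fiber_ne_top f hf1 hz)
              (simpleFunc_measure_fiber_ne_top f hf2 hz)]
            push_cast
            ring

end Laplace

/-! ### Exponential functional on bounded functions, and Chernoff's bound. -/

section Laplace

variable {Ω α : Type*} [MeasurableSpace Ω] [MeasurableSpace α] {P : Measure Ω}
  {R : Ω → Measure α} {Λ : Measure α}

lemma integrable_of_bounded_of_support {E : Type*} [NormedAddCommGroup E] {μ : Measure α}
    {g : α → E} (hg : AEStronglyMeasurable g μ) {M : ℝ} (hM : ∀ x, ‖g x‖ ≤ M) {B : Set α}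
    (hμ : μ B ≠ ∞) (hsupp : ∀ x ∉ B, g x = 0) : Integrable g μ := by
  have h : IntegrableOn g B μ :=
    Measure.integrableOn_of_bounded hμ hg (ae_of_all _ hM)
  rwa [integrableOn_iff_integrable_of_support_subset] at h
  intro x hx
  by_contra hxB
  exact hx (hsupp x hxB)

lemma simpleFunc_integrable_of_support (f : SimpleFunc α ℂ) {μ : Measure α} {B : Set α}
    (hμ : μ B ≠ ∞) (hsupp : ∀ x ∉ B, f x = 0) : Integrable f μ := by
  refine SimpleFunc.integrable_iff_finMeasSupp.2 ?_
  rw [SimpleFunc.finMeasSupp_iff_support]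
  refine lt_of_le_of_lt (measure_mono fun x hx => ?_) hμ.lt_top
  by_contra hxB
  exact hx (hsupp x hxB)

lemma HasPoissonLaplace.integral_cexp_simpleFunc' (h : HasPoissonLaplace R Λ P)
    (f : SimpleFunc α ℂ) {B : Set α} (hB : MeasurableSet B) (hΛ : Λ B ≠ ∞)
    (hsupp : ∀ x ∉ B, f x = 0) :
    ∫ ω, Complex.exp (∫ x, f x ∂(R ω)) ∂P = Complex.exp (∫ x, (Complex.exp (f x) - 1) ∂Λ) := by
  have hsub : Function.support f ⊆ B := fun x hx => by
    by_contra hxB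
    exact hx (hsupp x hxB)
  have hint := simpleFunc_integrable_of_support f hΛ hsupp
  have h1 := h.integral_cexp_simpleFunc f (ne_top_of_le_ne_top hΛ (measure_mono hsub))
  have h2 := f.map_integral (fun z => Complex.exp z - 1) hint (by simp)
  have h3 : Integrable (f.map fun z => Complex.exp z - 1) Λ :=
    simpleFunc_integrable_of_support _ hΛ (fun x hx => by simp [hsupp x hx])
  rw [SimpleFunc.integral_eq_integral _ h3] at h2
  simp only [Complex.real_smul, SimpleFunc.map_apply] at h2
  rw [h2, ← h1]
  refine integral_congr_ae ?_
  filter_upwards [h.ae_ne_top B hB hΛ] with ω hω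
  rw [SimpleFunc.integral_eq_integral _ (simpleFunc_integrable_of_support f hω hsupp)]

/-- The Bochner integral of a non-integrable function is `0`, while the formula on simple functions
gives an exponential, which is never `0`; so integrability comes for free. These functions are the
dominating ones in the passage from simple to bounded integrands. -/
lemma HasPoissonLaplace.integrable_exp_real (h : HasPoissonLaplace R Λ P) {B : Set α}
    (hB : MeasurableSet B) (hΛ : Λ B ≠ ∞) (t : ℝ) :
    Integrable (fun ω => Real.exp (t * (R ω).real B)) P := by
  classical
  let f : SimpleFunc α ℂ := SimpleFunc.piecewise B hB (SimpleFunc.const α (t : ℂ)) 0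
  have hf : (f : α → ℂ) = B.indicator fun _ => (t : ℂ) := by
    ext x
    simp [f, Set.indicator, Set.piecewise]
  have h1 := h.integral_cexp_simpleFunc' f hB hΛ (fun x hx => by simp [hf, hx])
  have h2 : Integrable (fun ω => Complex.exp (∫ x, f x ∂(R ω))) P :=
    Integrable.of_integral_ne_zero (by rw [h1]; exact Complex.exp_ne_zero _)
  refine h2.norm.congr (ae_of_all _ fun ω => ?_)
  simp only [Complex.norm_exp, hf]
  rw [integral_indicator hB, setIntegral_const]
  simp [mul_comm]

/-- Approximate `g` by simple functions bounded by `2M` and vanishing off `B`. Dominated convergence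
applies on both sides: under `P` with `exp(2M R(B))`, under `Λ` with a constant on `B`. -/
lemma HasPoissonLaplace.integral_cexp (h : HasPoissonLaplace R Λ P)
    {g : α → ℂ} (hg : Measurable g) {M : ℝ} (hM : ∀ x, ‖g x‖ ≤ M) {B : Set α}
    (hB : MeasurableSet B) (hΛ : Λ B ≠ ∞) (hsupp : ∀ x ∉ B, g x = 0) :
    AEStronglyMeasurable (fun ω => ∫ x, g x ∂(R ω)) P ∧
    Integrable (fun ω => Complex.exp (∫ x, g x ∂(R ω))) P ∧
    ∫ ω, Complex.exp (∫ x, g x ∂(R ω)) ∂P =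
      Complex.exp (∫ x, (Complex.exp (g x) - 1) ∂Λ) := by
  let f : ℕ → SimpleFunc α ℂ := SimpleFunc.approxOn g hg univ 0 (mem_univ _)
  have hf_tendsto : ∀ x, Tendsto (fun n => f n x) atTop (𝓝 (g x)) := fun x =>
    SimpleFunc.tendsto_approxOn hg (mem_univ _) (by simp)
  have hf_le : ∀ n x, ‖f n x‖ ≤ 2 * ‖g x‖ := fun n x => by
    have := SimpleFunc.norm_approxOn_zero_le hg (mem_univ (0 : ℂ)) x n
    linarith
  have hf_supp : ∀ n, ∀ x ∉ B, f n x = 0 := fun n x hx => by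
    have := hf_le n x
    rw [hsupp x hx, norm_zero, mul_zero] at this
    simpa using this
  have hf_bound : ∀ n x, ‖f n x‖ ≤ B.indicator (fun _ => 2 * M) x := fun n x => by
    by_cases hx : x ∈ B
    · simp only [hx, indicator_of_mem]
      linarith [hf_le n x, hM x]
    · simp [hx, hf_supp n x hx]
  have hlim : ∀ᵐ ω ∂P, Tendsto (fun n => ∫ x, f n x ∂(R ω)) atTop (𝓝 (∫ x, g x ∂(R ω))) := by
    filter_upwards [h.ae_ne_top B hB hΛ] with ω hω
    refine tendsto_integral_of_dominated_convergence (B.indicator fun _ => 2 * M)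
      (fun n => (f n).aestronglyMeasurable) ?_ (fun n => ae_of_all _ (hf_bound n))
      (ae_of_all _ hf_tendsto)
    exact (integrable_indicator_iff hB).2 (integrableOn_const hω)
  have hmeas_f : ∀ n, AEStronglyMeasurable (fun ω => ∫ x, f n x ∂(R ω)) P := by
    intro n
    have hm : Measurable fun ω => (f n).integral (R ω) := by
      simp only [SimpleFunc.integral_eq, Complex.real_smul, Measure.real]
      refine Finset.measurable_sum _ fun z _ => ?_
      exact (Complex.measurable_ofReal.comp ((Measure.measurable_coe
        ((f n).measurableSet_preimage _)).comp h.measurable).ennreal_toReal).mul_const z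
    refine hm.aestronglyMeasurable.congr ?_
    filter_upwards [h.ae_ne_top B hB hΛ] with ω hω
    rw [SimpleFunc.integral_eq_integral _ (simpleFunc_integrable_of_support _ hω (hf_supp n))]
  have hmeas := aestronglyMeasurable_of_tendsto_ae atTop hmeas_f hlim
  have hdom : ∀ᵐ ω ∂P, ∀ n, ‖Complex.exp (∫ x, f n x ∂(R ω))‖ ≤
      Real.exp (2 * M * (R ω).real B) := by
    filter_upwards [h.ae_ne_top B hB hΛ] with ω hω n
    rw [Complex.norm_exp]
    refine Real.exp_le_exp.2 ((Complex.re_le_norm _).trans ?_)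
    refine (norm_integral_le_of_norm_le ?_ (ae_of_all _ (hf_bound n))).trans ?_
    · exact (integrable_indicator_iff hB).2 (integrableOn_const hω)
    · rw [integral_indicator hB, setIntegral_const, smul_eq_mul, mul_comm]
  have hexp : Measurable Complex.exp := Complex.measurable_exp
  have hL := tendsto_integral_of_dominated_convergence
    (fun ω => Real.exp (2 * M * (R ω).real B))
    (fun n => Complex.continuous_exp.comp_aestronglyMeasurable (hmeas_f n))
    (h.integrable_exp_real hB hΛ (2 * M))
    (fun n => hdom.mono fun ω hω => hω n)
    (hlim.mono fun ω hω => (Complex.continuous_exp.tendsto _).comp hω)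
  simp only [h.integral_cexp_simpleFunc' _ hB hΛ (hf_supp _)] at hL
  have hR : Tendsto (fun n => ∫ x, (Complex.exp (f n x) - 1) ∂Λ) atTop
      (𝓝 (∫ x, (Complex.exp (g x) - 1) ∂Λ)) := by
    refine tendsto_integral_of_dominated_convergence
      (B.indicator fun _ => Real.exp (2 * M) + 1)
      (fun n => ?_) ((integrable_indicator_iff hB).2 (integrableOn_const hΛ))
      (fun n => ae_of_all _ fun x => ?_) (ae_of_all _ fun x => ?_)
    · exact ((hexp.comp (f n).measurable).sub_const 1).aestronglyMeasurable
    · by_cases hx : x ∈ B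
      · simp only [hx, indicator_of_mem]
        refine (norm_sub_le _ _).trans ?_
        rw [norm_one, Complex.norm_exp]
        gcongr
        exact (Complex.re_le_norm _).trans (by linarith [hf_le n x, hM x])
      · simp [hx, hf_supp n x hx]
    · exact ((Complex.continuous_exp.tendsto _).comp (hf_tendsto x)).sub_const 1
  have heq := tendsto_nhds_unique hL ((Complex.continuous_exp.tendsto _).comp hR)
  exact ⟨hmeas, Integrable.of_integral_ne_zero (by rw [heq]; exact Complex.exp_ne_zero _), heq⟩

/-- Chernoff's bound for a Poisson integral. -/
lemma HasPoissonLaplace.measure_le_integral_le (h : HasPoissonLaplace R Λ P)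
    [IsProbabilityMeasure P]
    {g : α → ℝ} (hg : Measurable g) {M : ℝ} (hM : ∀ x, |g x| ≤ M) {B : Set α}
    (hB : MeasurableSet B) (hΛ : Λ B ≠ ∞) (hsupp : ∀ x ∉ B, g x = 0) {t ε K : ℝ} (ht : 0 ≤ t)
    (hK : ∫ x, (Real.exp (t * g x) - 1) ∂Λ ≤ K) :
    P {ω | ε ≤ ∫ x, g x ∂(R ω)} ≤ ENNReal.ofReal (Real.exp (K - t * ε)) := by
  obtain ⟨-, h1, h2⟩ := h.integral_cexp (g := fun x => ((t * g x : ℝ) : ℂ))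
    (by fun_prop) (M := t * M) (fun x => by
      rw [Complex.norm_real, norm_mul, Real.norm_eq_abs, Real.norm_eq_abs, abs_of_nonneg ht]
      exact mul_le_mul_of_nonneg_left (hM x) ht) hB hΛ (fun x hx => by simp [hsupp x hx])
  have e1 : ∀ ω, Complex.exp (∫ x, ((t * g x : ℝ) : ℂ) ∂(R ω)) =
      ((Real.exp (t * ∫ x, g x ∂(R ω)) : ℝ) : ℂ) := fun ω => by
    rw [integral_complex_ofReal, integral_const_mul, Complex.ofReal_exp]
  have e2 : ∀ x, Complex.exp ((t * g x : ℝ) : ℂ) - 1 = ((Real.exp (t * g x) - 1 : ℝ) : ℂ) :=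
    fun x => by push_cast; rfl
  simp_rw [e1] at h1 h2
  simp_rw [e2] at h2
  rw [integral_complex_ofReal, integral_complex_ofReal, ← Complex.ofReal_exp,
    Complex.ofReal_inj] at h2
  have h1' : Integrable (fun ω => Real.exp (t * ∫ x, g x ∂(R ω))) P := h1.re
  have h3 := measure_ge_le_exp_mul_mgf (μ := P) (X := fun ω => ∫ x, g x ∂(R ω)) ε ht h1'
  rw [mgf, h2, ← Real.exp_add] at h3
  rw [← ofReal_measureReal]
  refine ENNReal.ofReal_le_ofReal (h3.trans (Real.exp_le_exp.2 ?_))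
  linarith

end Laplace

/-! ### The symmetric jump measure: moments and masses of shells. -/

noncomputable section

section Intensity

/-- The jump measure `(3/2) a |x|^{-5/2} dx` on the whole line. -/
def jumpMeasure (a : ℝ) : Measure ℝ :=
  volume.withDensity (fun x => ENNReal.ofReal (3 / 2 * a * |x| ^ (-(5 / 2) : ℝ)))

instance (a : ℝ) : SigmaFinite (jumpMeasure a) := by
  unfold jumpMeasure; infer_instance

instance (a : ℝ) : SigmaFinite (nuPlus a) := by
  unfold nuPlus; infer_instance

instance (a : ℝ) : SigmaFinite (nuMinus a) := by
  unfold nuMinus; infer_instance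

lemma measurable_jumpDensity (a : ℝ) :
    Measurable fun x : ℝ => ENNReal.ofReal (3 / 2 * a * |x| ^ (-(5 / 2) : ℝ)) := by
  fun_prop

lemma nuPlus_add_nuMinus (a : ℝ) : nuPlus a + nuMinus a = jumpMeasure a := by
  rw [nuPlus, nuMinus, jumpMeasure, ← withDensity_add_measure, add_comm,
    ← Measure.restrict_union (by
      rw [disjoint_left]; intro x hx hx'; exact lt_asymm (mem_Iio.1 hx) (mem_Ioi.1 hx'))
      measurableSet_Ioi, Iio_union_Ioi, Measure.restrict_eq_self_of_ae_mem]
  rw [ae_iff]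
  simp

lemma timeIntensity_add (a : ℝ) :
    timeIntensity (nuPlus a) + timeIntensity (nuMinus a) = timeIntensity (jumpMeasure a) := by
  rw [timeIntensity, timeIntensity, timeIntensity, ← Measure.prod_add, nuPlus_add_nuMinus]

lemma integral_jumpMeasure {E : Type*} [NormedAddCommGroup E] [NormedSpace ℝ E] {a : ℝ}
    (ha : 0 ≤ a) (f : ℝ → E) :
    ∫ x, f x ∂(jumpMeasure a) = ∫ x, (3 / 2 * a * |x| ^ (-(5 / 2) : ℝ)) • f x := by
  rw [jumpMeasure, integral_withDensity_eq_integral_toReal_smul (measurable_jumpDensity a)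
    (ae_of_all _ fun x => ENNReal.ofReal_lt_top)]
  refine integral_congr_ae (ae_of_all _ fun x => ?_)
  simp only
  rw [ENNReal.toReal_ofReal (by positivity)]

lemma integral_jumpMeasure_comp_neg {E : Type*} [NormedAddCommGroup E] [NormedSpace ℝ E] {a : ℝ}
    (ha : 0 ≤ a) (f : ℝ → E) :
    ∫ x, f (-x) ∂(jumpMeasure a) = ∫ x, f x ∂(jumpMeasure a) := by
  rw [integral_jumpMeasure ha, integral_jumpMeasure ha,
    ← integral_neg_eq_self (fun x => (3 / 2 * a * |x| ^ (-(5 / 2) : ℝ)) • f x)]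
  simp

/-- The source of all cancellation: on symmetric shells it removes the linear term from the Chernoff
exponents and the sine from the characteristic exponents. -/
lemma integral_jumpMeasure_of_odd {E : Type*} [NormedAddCommGroup E] [NormedSpace ℝ E] {a : ℝ}
    (ha : 0 ≤ a) {f : ℝ → E} (hf : ∀ x, f (-x) = -f x) :
    ∫ x, f x ∂(jumpMeasure a) = 0 := by
  have := integral_jumpMeasure_comp_neg ha f
  simp_rw [hf, integral_neg] at this
  have h2 : (2 : ℝ) • ∫ x, f x ∂(jumpMeasure a) = 0 := by
    rw [two_smul]
    nth_rewrite 1 [← this]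
    simp
  simpa using h2

lemma integrable_comp_abs {f : ℝ → ℝ} (hf : IntegrableOn f (Ioi 0)) :
    Integrable fun x => f |x| := by
  have h1 := (integrable_indicator_iff measurableSet_Ioi).2 hf
  refine (h1.add h1.comp_neg).congr ?_
  filter_upwards [compl_mem_ae_iff.2 (measure_singleton (0 : ℝ))] with x hx
  rcases lt_or_gt_of_ne (show x ≠ 0 from hx) with h | h
  · simp [abs_of_neg h, h, h.le]
  · simp [abs_of_pos h, h, h.le]

/-- Near `0` the bound `1 - cos y ≤ y²` leaves `y^(-1/2)`; beyond `1` the integrand is at most `2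
y^(-5/2)`. -/
lemma integrable_abs_rpow_mul_one_sub_cos :
    Integrable (fun y : ℝ => |y| ^ (-(5 / 2) : ℝ) * (1 - Real.cos y)) := by
  have key : IntegrableOn (fun y : ℝ => y ^ (-(5 / 2) : ℝ) * (1 - Real.cos y)) (Ioi 0) := by
    rw [← Ioc_union_Ioi_eq_Ioi (zero_le_one' ℝ)]
    refine IntegrableOn.union ?_ ?_
    · have h1 : IntegrableOn (fun y : ℝ => y ^ (-(1 / 2) : ℝ)) (Ioc 0 1) :=
        (intervalIntegrable_iff_integrableOn_Ioc_of_le zero_le_one).1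
          (intervalIntegral.intervalIntegrable_rpow' (by norm_num))
      refine Integrable.mono' h1 (by fun_prop) ?_
      refine (ae_restrict_iff' measurableSet_Ioc).2 (ae_of_all _ fun y hy => ?_)
      have hy0 : 0 < y := hy.1
      have hc : 0 ≤ 1 - Real.cos y := by linarith [Real.cos_le_one y]
      rw [Real.norm_of_nonneg (by positivity)]
      calc y ^ (-(5 / 2) : ℝ) * (1 - Real.cos y) ≤ y ^ (-(5 / 2) : ℝ) * y ^ (2 : ℝ) := by
            gcongr
            rw [Real.rpow_two]
            nlinarith [Real.one_sub_sq_div_two_le_cos (x := y)]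
        _ = y ^ (-(1 / 2) : ℝ) := by
            rw [← Real.rpow_add hy0]
            norm_num
    · have h1 : IntegrableOn (fun y : ℝ => y ^ (-(5 / 2) : ℝ) * 2) (Ioi 1) :=
        (integrableOn_Ioi_rpow_of_lt (by norm_num) one_pos).mul_const 2
      refine Integrable.mono' h1 (by fun_prop) ?_
      refine (ae_restrict_iff' measurableSet_Ioi).2 (ae_of_all _ fun y hy => ?_)
      have hy0 : 0 < y := one_pos.trans hy
      have hc : 0 ≤ 1 - Real.cos y := by linarith [Real.cos_le_one y]
      rw [Real.norm_of_nonneg (by positivity)]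
      gcongr
      linarith [Real.neg_one_le_cos y]
  simpa using! integrable_comp_abs key

lemma C₀_pos {a : ℝ} (ha : 0 < a) : 0 < C₀ a := by
  refine mul_pos (by positivity) ?_
  have h0 : (0 : ℝ → ℝ) ≤ fun y : ℝ => |y| ^ (-(5 / 2) : ℝ) * (1 - Real.cos y) := fun y => by
    have hc : 0 ≤ 1 - Real.cos y := by linarith [Real.cos_le_one y]
    simp only [Pi.zero_apply]
    positivity
  rw [integral_pos_iff_support_of_nonneg h0 integrable_abs_rpow_mul_one_sub_cos]
  refine lt_of_lt_of_le (b := volume (Ioo (0 : ℝ) 1)) (by simp) (measure_mono fun y hy => ?_)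
  have hy0 : 0 < |y| := abs_pos.2 hy.1.ne'
  refine mul_ne_zero (Real.rpow_pos_of_pos hy0 _).ne' fun h => ?_
  have hpi := Real.pi_gt_three
  have := (Real.cos_eq_one_iff_of_lt_of_lt (x := y) (by linarith [hy.1]) (by linarith [hy.2])).1
    (by linarith)
  exact hy.1.ne' this

lemma abs_rpow_scaling {h : ℝ} (hh : h ≠ 0) (x : ℝ) :
    |x| ^ (-(5 / 2) : ℝ) * (1 - Real.cos (h * x)) =
      |h| ^ (5 / 2 : ℝ) * (|h * x| ^ (-(5 / 2) : ℝ) * (1 - Real.cos (h * x))) := by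
  have hp : 0 < |h| := abs_pos.2 hh
  rw [abs_mul, Real.mul_rpow hp.le (abs_nonneg x), ← mul_assoc, ← mul_assoc,
    ← Real.rpow_add hp]
  norm_num

lemma integrable_one_sub_cos {a : ℝ} (ha : 0 ≤ a) (h : ℝ) :
    Integrable (fun x => 1 - Real.cos (h * x)) (jumpMeasure a) := by
  rw [jumpMeasure, integrable_withDensity_iff_integrable_smul' (measurable_jumpDensity a)
    (ae_of_all _ fun x => ENNReal.ofReal_lt_top)]
  rcases eq_or_ne h 0 with rfl | hh
  · simp
  refine (((integrable_abs_rpow_mul_one_sub_cos.comp_mul_left' hh).const_mul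
    (|h| ^ (5 / 2 : ℝ))).const_mul (3 / 2 * a)).congr (ae_of_all _ fun x => ?_)
  simp only [smul_eq_mul]
  rw [ENNReal.toReal_ofReal (by positivity), mul_assoc (3 / 2 * a), abs_rpow_scaling hh]

/-- Substitute `y = h x`: the density contributes `|h|^(5/2)` and the Jacobian `|h|^(-1)`, which
produces the exponent `3/2`. -/
lemma integral_one_sub_cos {a : ℝ} (ha : 0 ≤ a) (h : ℝ) :
    ∫ x, (1 - Real.cos (h * x)) ∂(jumpMeasure a) = C₀ a * |h| ^ (3 / 2 : ℝ) := by
  rw [integral_jumpMeasure ha]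
  rcases eq_or_ne h 0 with rfl | hh
  · simp [Real.zero_rpow]
  have hp : 0 < |h| := abs_pos.2 hh
  simp only [smul_eq_mul, mul_assoc (3 / 2 * a), abs_rpow_scaling hh]
  rw [integral_const_mul, integral_const_mul,
    Measure.integral_comp_mul_left (fun x => |x| ^ (-(5 / 2) : ℝ) * (1 - Real.cos x)) h, C₀,
    smul_eq_mul, abs_inv, ← Real.rpow_neg_one |h|]
  have : |h| ^ (3 / 2 : ℝ) = |h| ^ (5 / 2 : ℝ) * |h| ^ (-1 : ℝ) := by
    rw [← Real.rpow_add hp]; norm_num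
  rw [this]
  ring

lemma jumpMeasure_abs_gt_lt_top (a : ℝ) {c : ℝ} (hc : 0 < c) :
    jumpMeasure a {x | c < |x|} < ∞ := by
  have hS : MeasurableSet {x : ℝ | c < |x|} := measurableSet_lt measurable_const (by fun_prop)
  rw [jumpMeasure, withDensity_apply _ hS]
  have h1 : IntegrableOn (fun x : ℝ => (Ioi c).indicator (fun x => x ^ (-(5 / 2) : ℝ)) x)
      (Ioi 0) :=
    ((integrable_indicator_iff measurableSet_Ioi).2
      (integrableOn_Ioi_rpow_of_lt (by norm_num) hc)).integrableOn
  have h2 := ((integrable_comp_abs h1).const_mul (3 / 2 * a)).lintegral_lt_top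
  refine lt_of_le_of_lt ?_ h2
  rw [← lintegral_indicator hS]
  refine lintegral_mono fun x => ?_
  by_cases hx : c < |x| <;> simp [hx]

/-- The jumps of modulus in `(u, v]`. -/
def shell (u v : ℝ) : Set ℝ := {x | u < |x| ∧ |x| ≤ v}

lemma measurableSet_shell (u v : ℝ) : MeasurableSet (shell u v) := by
  unfold shell
  exact (measurableSet_lt measurable_const continuous_abs.measurable).inter
    (measurableSet_le continuous_abs.measurable measurable_const)

lemma neg_mem_shell {u v x : ℝ} : -x ∈ shell u v ↔ x ∈ shell u v := by
  simp [shell]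

lemma jumpMeasure_shell_lt_top (a : ℝ) {u : ℝ} (hu : 0 < u) (v : ℝ) :
    jumpMeasure a (shell u v) < ∞ :=
  lt_of_le_of_lt (measure_mono fun _ hx => hx.1) (jumpMeasure_abs_gt_lt_top a hu)

/-- Largest density times length. The factor `v - u` makes thin shells light, and `D` can be one
bound valid for all shells of a scale. -/
lemma jumpMeasure_real_shell_le {a : ℝ} (ha : 0 ≤ a) {u v D : ℝ} (hu : 0 < u) (huv : u ≤ v)
    (hD : u ^ (-(5 / 2) : ℝ) ≤ D) : (jumpMeasure a).real (shell u v) ≤ 3 * a * D * (v - u) := by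
  have hD0 : 0 ≤ D := (by positivity : (0 : ℝ) ≤ u ^ (-(5 / 2) : ℝ)).trans hD
  have hvu : 0 ≤ v - u := sub_nonneg.2 huv
  refine ENNReal.toReal_le_of_le_ofReal (by positivity) ?_
  rw [jumpMeasure, withDensity_apply _ (measurableSet_shell u v)]
  calc ∫⁻ x in shell u v, ENNReal.ofReal (3 / 2 * a * |x| ^ (-(5 / 2) : ℝ))
      ≤ ∫⁻ _ in shell u v, ENNReal.ofReal (3 / 2 * a * D) := by
        refine setLIntegral_mono measurable_const fun x hx => ENNReal.ofReal_le_ofReal ?_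
        gcongr
        exact (Real.rpow_le_rpow_of_nonpos hu hx.1.le (by norm_num)).trans hD
    _ ≤ ENNReal.ofReal (3 / 2 * a * D) * ENNReal.ofReal (2 * (v - u)) := by
        rw [setLIntegral_const]
        gcongr
        calc volume (shell u v) ≤ volume (Ioc u v ∪ Ico (-v) (-u)) := by
              refine measure_mono fun x hx => ?_
              rcases le_total 0 x with h | h
              · left
                simpa [shell, abs_of_nonneg h] using hx
              · right
                simp only [shell, abs_of_nonpos h, mem_ofPred_eq] at hx
                exact ⟨by linarith [hx.2], by linarith [hx.1]⟩
          _ ≤ volume (Ioc u v) + volume (Ico (-v) (-u)) := measure_union_le _ _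
          _ = ENNReal.ofReal (2 * (v - u)) := by
              rw [Real.volume_Ioc, Real.volume_Ico, ← ENNReal.ofReal_add hvu (by linarith)]
              congr 1
              ring
    _ = ENNReal.ofReal (3 * a * D * (v - u)) := by
        rw [← ENNReal.ofReal_mul (by positivity)]
        congr 1
        ring

end Intensity

end

/-! ### Exponential tail bounds for sums over a time set times a shell. -/

section Tail

variable {Ω : Type*} [MeasurableSpace Ω] {P : Measure Ω} [IsProbabilityMeasure P]
  {R : Ω → Measure (ℝ × ℝ)} {a : ℝ}

lemma timeIntensity_prod_lt_top {ν : Measure ℝ} [SFinite ν] {I S : Set ℝ} (hI : volume I ≠ ∞)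
    (hS : ν S ≠ ∞) : timeIntensity ν (I ×ˢ S) < ∞ := by
  rw [timeIntensity, Measure.prod_prod]
  exact ENNReal.mul_lt_top ((Measure.restrict_apply_le _ _).trans_lt hI.lt_top) hS.lt_top

lemma HasPoissonLaplace.measure_le_setIntegral_le
    (hR : HasPoissonLaplace R (timeIntensity (jumpMeasure a)) P) {φ : ℝ → ℝ} (hφ : Measurable φ)
    {I : Set ℝ} (hI : MeasurableSet I) {L : ℝ} (hL : volume I ≤ ENNReal.ofReal L) (hL0 : 0 ≤ L)
    {u v : ℝ} (hu : 0 < u) (hv : 0 ≤ v) (hφv : ∀ x ∈ shell u v, |φ x| ≤ v) {t κ ε : ℝ} (ht : 0 ≤ t)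
    (hκ0 : 0 ≤ κ) (hκ : ∫ x in shell u v, (Real.exp (t * φ x) - 1) ∂(jumpMeasure a) ≤ κ) :
    P {ω | ε ≤ ∫ p in I ×ˢ shell u v, φ p.2 ∂(R ω)} ≤
      ENNReal.ofReal (Real.exp (L * κ - t * ε)) := by
  have hS := measurableSet_shell u v
  have hIS : MeasurableSet (I ×ˢ shell u v) := hI.prod hS
  have hfin : timeIntensity (jumpMeasure a) (I ×ˢ shell u v) ≠ ∞ :=
    (timeIntensity_prod_lt_top (ne_top_of_le_ne_top ENNReal.ofReal_ne_top hL)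
      (jumpMeasure_shell_lt_top a hu v).ne).ne
  have key := hR.measure_le_integral_le
    (g := (I ×ˢ shell u v).indicator fun p => φ p.2)
    ((hφ.comp measurable_snd).indicator hIS) (M := v) (fun p => by
      by_cases hp : p ∈ I ×ˢ shell u v
      · rw [indicator_of_mem hp]; exact hφv _ hp.2
      · rw [indicator_of_notMem hp, abs_zero]; exact hv) hIS hfin
    (fun p hp => indicator_of_notMem hp _) (t := t) (ε := ε) (K := L * κ) ht (by
      have e1 : (fun p : ℝ × ℝ =>
          Real.exp (t * (I ×ˢ shell u v).indicator (fun p => φ p.2) p) - 1) =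
          (I ×ˢ shell u v).indicator fun p => 1 * (Real.exp (t * φ p.2) - 1) := by
        ext p
        by_cases hp : p ∈ I ×ˢ shell u v
        · rw [indicator_of_mem hp, indicator_of_mem hp, one_mul]
        · rw [indicator_of_notMem hp, indicator_of_notMem hp]; simp
      rw [e1, integral_indicator hIS, timeIntensity,
        setIntegral_prod_mul (fun _ => (1 : ℝ)) (fun x => Real.exp (t * φ x) - 1)]
      have h1 : ∫ _ in I, (1 : ℝ) ∂(volume.restrict (Ici (0 : ℝ))) ≤ L := by
        simp only [integral_const, smul_eq_mul, mul_one, Measure.real, Measure.restrict_apply_univ]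
        exact ENNReal.toReal_le_of_le_ofReal hL0 ((Measure.restrict_apply_le _ _).trans hL)
      have h0 : 0 ≤ ∫ _ in I, (1 : ℝ) ∂(volume.restrict (Ici (0 : ℝ))) :=
        integral_nonneg fun _ => zero_le_one
      calc _ ≤ (∫ _ in I, (1 : ℝ) ∂(volume.restrict (Ici (0 : ℝ)))) * κ := by gcongr
        _ ≤ L * κ := by gcongr)
  simp_rw [integral_indicator hIS] at key
  exact key

/-- From `|exp y - 1| ≤ 2|y|` for `|y| ≤ 1`. Being of first order in `t v`, the exponent is useful
only on regions of small intensity, such as the thin slabs and shells of the grid. -/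
lemma HasPoissonLaplace.measure_le_setIntegral_abs_le
    (hR : HasPoissonLaplace R (timeIntensity (jumpMeasure a)) P)
    {I : Set ℝ} (hI : MeasurableSet I) {L : ℝ} (hL : volume I ≤ ENNReal.ofReal L) (hL0 : 0 ≤ L)
    {u v : ℝ} (hu : 0 < u) (hv : 0 ≤ v) {t ε : ℝ} (ht : 0 ≤ t) (htv : t * v ≤ 1) :
    P {ω | ε ≤ ∫ p in I ×ˢ shell u v, |p.2| ∂(R ω)} ≤
      ENNReal.ofReal (Real.exp
        (L * (2 * (t * v) * (jumpMeasure a).real (shell u v)) - t * ε)) := by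
  refine hR.measure_le_setIntegral_le (φ := fun x => |x|) (by fun_prop) hI hL hL0 hu hv
    (fun x hx => by rw [abs_abs]; exact hx.2) ht (by positivity) ?_
  refine (Real.le_norm_self _).trans (norm_setIntegral_le_of_norm_le_const
    (jumpMeasure_shell_lt_top a hu v) fun x hx => ?_)
  have h1 : |(t * |x|)| = t * |x| := abs_of_nonneg (by positivity)
  have h2 : t * |x| ≤ t * v := mul_le_mul_of_nonneg_left hx.2 ht
  rw [Real.norm_eq_abs]
  refine (Real.abs_exp_sub_one_le (h1.le.trans (h2.trans htv))).trans ?_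
  rw [h1]
  linarith

/-- The linear term integrates to zero over the symmetric shell, and `|exp y - 1 - y| ≤ y²` for `|y|
≤ 1`. The gain of a factor `t v` over the first-order bound makes whole shells manageable. The sign
`σ` covers both tails. -/
lemma HasPoissonLaplace.measure_le_setIntegral_mul_le
    (hR : HasPoissonLaplace R (timeIntensity (jumpMeasure a)) P) (ha : 0 ≤ a)
    {I : Set ℝ} (hI : MeasurableSet I) {L : ℝ} (hL : volume I ≤ ENNReal.ofReal L) (hL0 : 0 ≤ L)
    {u v : ℝ} (hu : 0 < u) (hv : 0 ≤ v) {t ε : ℝ} (ht : 0 ≤ t) (htv : t * v ≤ 1) {σ : ℝ}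
    (hσ : |σ| = 1) :
    P {ω | ε ≤ ∫ p in I ×ˢ shell u v, σ * p.2 ∂(R ω)} ≤
      ENNReal.ofReal (Real.exp
        (L * ((t * v) ^ 2 * (jumpMeasure a).real (shell u v)) - t * ε)) := by
  refine hR.measure_le_setIntegral_le (φ := fun x => σ * x) (by fun_prop) hI hL hL0 hu hv
    (fun x hx => by rw [abs_mul, hσ, one_mul]; exact hx.2) ht (by positivity) ?_
  have hS := measurableSet_shell u v
  have hν := jumpMeasure_shell_lt_top a hu v
  have hle : ∀ x ∈ shell u v, |t * (σ * x)| ≤ t * v := fun x hx => by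
    rw [abs_mul, abs_mul, hσ, one_mul, abs_of_nonneg ht]
    exact mul_le_mul_of_nonneg_left hx.2 ht
  have hodd : ∫ x in shell u v, t * (σ * x) ∂(jumpMeasure a) = 0 := by
    rw [← integral_indicator hS]
    refine integral_jumpMeasure_of_odd ha fun x => ?_
    by_cases hx : x ∈ shell u v
    · rw [indicator_of_mem hx, indicator_of_mem (neg_mem_shell.2 hx)]; ring
    · rw [indicator_of_notMem hx, indicator_of_notMem (mt neg_mem_shell.1 hx), neg_zero]
  have hint1 : IntegrableOn (fun x => Real.exp (t * (σ * x)) - 1 - t * (σ * x)) (shell u v)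
      (jumpMeasure a) :=
    Measure.integrableOn_of_bounded hν.ne (by fun_prop) (M := (t * v) ^ 2)
      ((ae_restrict_iff' hS).2 (ae_of_all _ fun x hx => by
        rw [Real.norm_eq_abs]
        refine (Real.abs_exp_sub_one_sub_id_le ((hle x hx).trans htv)).trans ?_
        exact sq_le_sq' (abs_le.1 (hle x hx)).1 (abs_le.1 (hle x hx)).2))
  have hint2 : IntegrableOn (fun x => t * (σ * x)) (shell u v) (jumpMeasure a) :=
    Measure.integrableOn_of_bounded hν.ne (by fun_prop) (M := t * v)
      ((ae_restrict_iff' hS).2 (ae_of_all _ fun x hx => hle x hx))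
  calc ∫ x in shell u v, (Real.exp (t * (σ * x)) - 1) ∂(jumpMeasure a)
      = ∫ x in shell u v, ((Real.exp (t * (σ * x)) - 1 - t * (σ * x)) + t * (σ * x))
          ∂(jumpMeasure a) := by
        congr 1; ext x; ring
    _ = ∫ x in shell u v, (Real.exp (t * (σ * x)) - 1 - t * (σ * x)) ∂(jumpMeasure a) := by
        rw [integral_add hint1 hint2, hodd, add_zero]
    _ ≤ (t * v) ^ 2 * (jumpMeasure a).real (shell u v) := by
        refine (Real.le_norm_self _).trans (norm_setIntegral_le_of_norm_le_const hν fun x hx => ?_)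
        rw [Real.norm_eq_abs]
        refine (Real.abs_exp_sub_one_sub_id_le ((hle x hx).trans htv)).trans ?_
        exact sq_le_sq' (abs_le.1 (hle x hx)).1 (abs_le.1 (hle x hx)).2

end Tail

/-! ### Deterministic estimates: from a grid to all times and cut-offs. -/

noncomputable section

section Deterministic

/-- The jumps of modulus larger than `c`. -/
def bigJumps (c : ℝ) : Set ℝ := {x | c < |x|}

lemma measurableSet_bigJumps (c : ℝ) : MeasurableSet (bigJumps c) :=
  measurableSet_lt measurable_const continuous_abs.measurable

/-- The sum of the jumps of modulus larger than `c` up to time `θ`. -/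
def jumpSum (μ : Measure (ℝ × ℝ)) (c θ : ℝ) : ℝ := ∫ p in Icc 0 θ ×ˢ bigJumps c, p.2 ∂μ

/-- Only finitely many large jumps in bounded time, with a finite sum. -/
structure TameJumps (μ : Measure (ℝ × ℝ)) : Prop where
  lt_top : ∀ c : ℝ, 0 < c → ∀ θ : ℝ, μ (Icc 0 θ ×ˢ bigJumps c) < ∞
  integrableOn : ∀ c : ℝ, 0 < c → ∀ θ : ℝ,
    IntegrableOn (fun p : ℝ × ℝ => p.2) (Icc 0 θ ×ˢ bigJumps c) μ

variable {μ : Measure (ℝ × ℝ)}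

lemma shell_subset_bigJumps (u v : ℝ) : shell u v ⊆ bigJumps u := fun _ hx => hx.1

lemma TameJumps.integrableOn_shell (h : TameJumps μ) {c : ℝ} (hc : 0 < c) (v : ℝ) {I : Set ℝ}
    {θ : ℝ} (hI : I ⊆ Icc 0 θ) :
    IntegrableOn (fun p : ℝ × ℝ => p.2) (I ×ˢ shell c v) μ :=
  (h.integrableOn c hc θ).mono_set (prod_mono hI (shell_subset_bigJumps _ _))

lemma TameJumps.jumpSum_sub (h : TameJumps μ) {c v : ℝ} (hc : 0 < c) (hcv : c ≤ v) (θ : ℝ) :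
    jumpSum μ c θ - jumpSum μ v θ = ∫ p in Icc 0 θ ×ˢ shell c v, p.2 ∂μ := by
  have hsub : Icc 0 θ ×ˢ bigJumps v ⊆ Icc 0 θ ×ˢ bigJumps c :=
    prod_mono subset_rfl fun x hx => lt_of_le_of_lt hcv hx
  rw [jumpSum, jumpSum, ← setIntegral_sdiff (measurableSet_Icc.prod (measurableSet_bigJumps v))
    (h.integrableOn c hc θ) hsub]
  congr 2
  ext p
  simp only [bigJumps, shell, Set.mem_sdiff, mem_prod, mem_ofPred_eq, not_and, not_lt]
  tauto

lemma abs_setIntegral_sub_le {α : Type*} [MeasurableSpace α] {μ : Measure α} {f : α → ℝ}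
    {A B C D : Set α} (hB : MeasurableSet B) (hC : MeasurableSet C)
    (hD : MeasurableSet D) (hBA : B ⊆ A) (hsub : A \ B ⊆ C ∪ D) (hfA : IntegrableOn f A μ)
    (hfC : IntegrableOn f C μ) (hfD : IntegrableOn f D μ) :
    |∫ x in A, f x ∂μ - ∫ x in B, f x ∂μ| ≤ ∫ x in C, |f x| ∂μ + ∫ x in D, |f x| ∂μ := by
  rw [← setIntegral_sdiff hB hfA hBA]
  have hfC' : IntegrableOn (fun x => |f x|) C μ := hfC.abs
  have hfD' : IntegrableOn (fun x => |f x|) D μ := hfD.abs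
  calc |∫ x in A \ B, f x ∂μ| ≤ ∫ x in A \ B, |f x| ∂μ := abs_integral_le_integral_abs
    _ ≤ ∫ x in C ∪ D, |f x| ∂μ :=
        setIntegral_mono_set (hfC'.union hfD') (ae_of_all _ fun x => abs_nonneg _)
          (ae_of_all _ hsub)
    _ = ∫ x in C, |f x| ∂μ + ∫ x in D \ C, |f x| ∂μ := by
        rw [← union_sdiff_self, setIntegral_union disjoint_sdiff_right (hD.diff hC) hfC'
          (hfD'.mono_set sdiff_subset)]
    _ ≤ ∫ x in C, |f x| ∂μ + ∫ x in D, |f x| ∂μ := by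
        refine add_le_add le_rfl ?_
        exact setIntegral_mono_set hfD' (ae_of_all _ fun x => abs_nonneg _)
          (ae_of_all _ sdiff_subset)

lemma exists_grid_cell {x δ : ℝ} (hδ : 0 < δ) (hx : 0 ≤ x) :
    ∃ i : ℕ, i * δ ≤ x ∧ x < (i + 1) * δ := by
  refine ⟨⌊x / δ⌋₊, ?_, ?_⟩
  · rw [← le_div_iff₀ hδ]
    exact Nat.floor_le (by positivity)
  · rw [← div_lt_iff₀ hδ]
    exact Nat.lt_floor_add_one _

/-- If the sums over the cells of a grid of mesh `τ` in time and `δ` in jump size are at most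
`ε`, then all sums are at most `3 ε`. -/
lemma TameJumps.abs_setIntegral_le_of_grid (h : TameJumps μ) {u v τ δ ε : ℝ} {n : ℕ}
    (hu : 0 < u) (hτ : 0 < τ) (hδ : 0 < δ) (huv : u + n * δ = v)
    (h1 : ∀ i < n, ∀ j ≤ n, |∫ p in Icc 0 (j * τ) ×ˢ shell (u + (i + 1) * δ) v, p.2 ∂μ| ≤ ε)
    (h2 : ∀ j ≤ n, ∫ p in Ioc (j * τ) ((j + 1) * τ) ×ˢ shell u v, |p.2| ∂μ ≤ ε)
    (h3 : ∀ i < n, ∫ p in Icc 0 (n * τ) ×ˢ shell (u + i * δ) (u + (i + 1) * δ), |p.2| ∂μ ≤ ε)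
    {θ c : ℝ} (hθ : 0 ≤ θ) (hθn : θ ≤ n * τ) (huc : u ≤ c) (hcv : c < v) :
    |∫ p in Icc 0 θ ×ˢ shell c v, p.2 ∂μ| ≤ 3 * ε := by
  obtain ⟨j, hj, hj'⟩ := exists_grid_cell hτ hθ
  obtain ⟨i, hi, hi'⟩ := exists_grid_cell hδ (sub_nonneg.2 huc)
  have hjn : j ≤ n := by
    have : (j : ℝ) * τ ≤ n * τ := hj.trans hθn
    exact_mod_cast le_of_mul_le_mul_right this hτ
  have hin : i < n := by
    have : (i : ℝ) * δ < n * δ := by linarith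
    exact_mod_cast lt_of_mul_lt_mul_right this hδ.le
  have hiδ : (0 : ℝ) ≤ i * δ := by positivity
  have hjτ : (0 : ℝ) ≤ j * τ := by positivity
  -- Round `θ` down to the grid time `j τ` and `c` up to the grid size `u + (i + 1) δ`. The lost
  -- region lies in a thin shell over all times together with a thin time slab over all sizes; with
  -- the grid value this makes three terms `ε`.
  have key := abs_setIntegral_sub_le (μ := μ) (f := fun p : ℝ × ℝ => p.2)
    (A := Icc 0 θ ×ˢ shell c v) (B := Icc 0 (j * τ) ×ˢ shell (u + (i + 1) * δ) v)
    (C := Icc 0 (n * τ) ×ˢ shell (u + i * δ) (u + (i + 1) * δ))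
    (D := Ioc (j * τ) ((j + 1) * τ) ×ˢ shell u v)
    (measurableSet_Icc.prod (measurableSet_shell _ _))
    (measurableSet_Icc.prod (measurableSet_shell _ _))
    (measurableSet_Ioc.prod (measurableSet_shell _ _))
    (prod_mono (Icc_subset_Icc_right hj) fun x hx => ⟨by linarith [hx.1], hx.2⟩)
    (by
      rintro ⟨s, x⟩ ⟨⟨hs, hx⟩, hn⟩
      by_cases hx2 : u + (i + 1) * δ < |x|
      · right
        have hsj : j * τ < s := by
          by_contra hcon
          exact hn ⟨⟨hs.1, not_lt.1 hcon⟩, hx2, hx.2⟩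
        exact ⟨⟨hsj, hs.2.trans hj'.le⟩, huc.trans_lt hx.1, hx.2⟩
      · left
        exact ⟨⟨hs.1, hs.2.trans hθn⟩, by linarith [hx.1], not_lt.1 hx2⟩)
    (h.integrableOn_shell (hu.trans_le huc) v subset_rfl)
    (h.integrableOn_shell (by linarith) _ subset_rfl)
    (h.integrableOn_shell hu v (θ := (j + 1) * τ)
      fun x hx => ⟨hjτ.trans hx.1.le, hx.2⟩)
  have a1 := h1 i hin j hjn
  have a2 := h2 j hjn
  have a3 := h3 i hin
  rw [abs_le] at key a1 ⊢
  constructor <;> linarith [key.1, key.2, a1.1, a1.2]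

/-- Summation over the shells `[r (m+1), r m)`. -/
lemma abs_sub_le_of_shells {r : ℕ → ℝ} {f : ℝ → ℝ} {m₀ : ℕ}
    (h : ∀ m ≥ m₀, ∀ c, r (m + 1) ≤ c → c < r m → |f c - f (r m)| ≤ 3 * (1 / 2) ^ m)
    {m : ℕ} (hm : m₀ ≤ m) (k : ℕ) (c : ℝ) (hc : r (m + k) ≤ c) (hcm : c ≤ r m)
    (hr : Antitone r) :
    |f c - f (r m)| ≤ 6 * (1 / 2) ^ m - 6 * (1 / 2) ^ (m + k) := by
  -- The right side is the geometric sum of `3 (1/2)^n` over `m ≤ n < m + k`.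
  induction k generalizing c with
  | zero =>
    obtain rfl : c = r m := le_antisymm hcm hc
    simp
  | succ k ih =>
    rcases le_or_gt (r (m + k)) c with h1 | h1
    · refine (ih c h1 hcm).trans ?_
      rw [← add_assoc, pow_succ]
      have : (0 : ℝ) ≤ (1 / 2) ^ (m + k) := by positivity
      linarith
    · have h2 := h (m + k) (by omega) c hc h1
      have h3 := ih (r (m + k)) le_rfl (hr (by omega))
      have h4 := abs_sub_le (f c) (f (r (m + k))) (f (r m))
      rw [← add_assoc, pow_succ]
      linarith

end Deterministic

end

/-! ### Almost sure uniform Cauchy property by Borel–Cantelli. -/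

noncomputable section

section UniformCauchy

variable {Ω : Type*} [MeasurableSpace Ω] {P : Measure Ω} [IsProbabilityMeasure P]
  {R : Ω → Measure (ℝ × ℝ)} {a : ℝ}

/-- The scale `2^{-8m}` separating consecutive ranges of jump sizes. -/
def scale (m : ℕ) : ℝ := (((2 : ℝ) ^ m) ^ 8)⁻¹

/-- The mesh of the grid of jump sizes between two consecutive scales. -/
def sizeMesh (m : ℕ) : ℝ := (scale m - scale (m + 1)) / ((2 : ℝ) ^ m) ^ 6

/-- The mesh of the grid of times. -/
def timeMesh (T : ℝ) (m : ℕ) : ℝ := T / ((2 : ℝ) ^ m) ^ 6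

lemma scale_pos (m : ℕ) : 0 < scale m := by unfold scale; positivity

lemma scale_succ (m : ℕ) : scale (m + 1) = scale m / 256 := by
  unfold scale; rw [pow_succ (2 : ℝ) m, mul_pow, mul_inv]; norm_num; ring

lemma scale_antitone : Antitone scale :=
  antitone_nat_of_succ_le fun m => by
    rw [scale_succ]; linarith [scale_pos m]

lemma tendsto_scale : Tendsto scale atTop (𝓝 0) := by
  have : scale = fun m => ((1 / 256 : ℝ)) ^ m := by
    ext m
    rw [scale, ← pow_mul, mul_comm, pow_mul, ← inv_pow]
    norm_num
  rw [this]
  exact tendsto_pow_atTop_nhds_zero_of_lt_one (by norm_num) (by norm_num)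

lemma sizeMesh_pos (m : ℕ) : 0 < sizeMesh m := by
  have := scale_pos m
  unfold sizeMesh
  rw [scale_succ]
  refine div_pos (by linarith) (by positivity)

lemma scale_succ_add_mesh (m : ℕ) :
    scale (m + 1) + (((2 ^ m) ^ 6 : ℕ) : ℝ) * sizeMesh m = scale m := by
  unfold sizeMesh
  push_cast
  field_simp
  ring

lemma scale_succ_rpow_le (m : ℕ) {u : ℝ} (hu : scale (m + 1) ≤ u) :
    u ^ (-(5 / 2) : ℝ) ≤ 2 ^ 20 * ((2 : ℝ) ^ m) ^ 20 := by
  refine (Real.rpow_le_rpow_of_nonpos (scale_pos _) hu (by norm_num)).trans (le_of_eq ?_)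
  rw [scale, Real.inv_rpow (by positivity), Real.rpow_neg (by positivity), inv_inv,
    ← Real.rpow_natCast, ← Real.rpow_mul (by positivity), pow_succ (2 : ℝ) m, mul_comm,
    ← mul_pow, ← Real.rpow_natCast]
  norm_num [mul_comm]

/-- The event that one of the sums over the cells with index `(i, j)` of the grid of level `m` is
large. -/
def badCell (R : Ω → Measure (ℝ × ℝ)) (T : ℝ) (m i j : ℕ) : Set Ω :=
  {ω | (1 / 2 : ℝ) ^ m ≤ ∫ p in Icc 0 (j * timeMesh T m) ×ˢ
          shell (scale (m + 1) + (i + 1) * sizeMesh m) (scale m), 1 * p.2 ∂(R ω)} ∪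
        {ω | (1 / 2 : ℝ) ^ m ≤ ∫ p in Icc 0 (j * timeMesh T m) ×ˢ
          shell (scale (m + 1) + (i + 1) * sizeMesh m) (scale m), (-1) * p.2 ∂(R ω)} ∪
        ({ω | (1 / 2 : ℝ) ^ m ≤ ∫ p in Ioc (j * timeMesh T m) ((j + 1) * timeMesh T m) ×ˢ
          shell (scale (m + 1)) (scale m), |p.2| ∂(R ω)} ∪
        {ω | (1 / 2 : ℝ) ^ m ≤ ∫ p in Icc 0 T ×ˢ
          shell (scale (m + 1) + i * sizeMesh m) (scale (m + 1) + (i + 1) * sizeMesh m),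
            |p.2| ∂(R ω)})

/-- With `N = 2^m`, take `t = N^2` and threshold `1/N`, so that `t ε = N`; then `v = N^(-8)` gives
`t v = N^(-6)`, and the full shell has mass of order `N^12`. The exponents are then bounded up to
the `-N`. For signed sums, `(t v)^2` offsets `N^12`. For a time slab, `t v` and the length `T / N^6`
do so together. For a thin shell, of width at most `N^(-14)`, the mass is of order `N^6` and `t v`
alone suffices. -/
lemma HasPoissonLaplace.measure_badCell_le
    (hR : HasPoissonLaplace R (timeIntensity (jumpMeasure a)) P) (ha : 0 ≤ a) {T : ℝ}
    (hT : 0 < T) (m i j : ℕ) (hi : i < (2 ^ m) ^ 6) (hj : j ≤ (2 ^ m) ^ 6) :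
    P (badCell R T m i j) ≤
      4 * ENNReal.ofReal (Real.exp (6 * a * T * 2 ^ 20 - 2 ^ m)) := by
  set N : ℝ := (2 : ℝ) ^ m with hN
  have hN1 : 1 ≤ N := one_le_pow₀ one_le_two
  have hN0 : 0 < N := one_pos.trans_le hN1
  set u := scale (m + 1) with hu_def
  set v := scale m with hv_def
  set δ := sizeMesh m with hδ_def
  have hvN : v = (N ^ 8)⁻¹ := rfl
  have hu : 0 < u := scale_pos _
  have hv : 0 < v := scale_pos _
  have hδ : 0 < δ := sizeMesh_pos _
  have hmesh : u + N ^ 6 * δ = v := by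
    have := scale_succ_add_mesh m
    push_cast at this
    exact this
  have hi' : ((i : ℝ) + 1) ≤ N ^ 6 := by
    have : i + 1 ≤ (2 ^ m) ^ 6 := hi
    rw [hN]
    exact_mod_cast this
  have hj' : (j : ℝ) ≤ N ^ 6 := by
    rw [hN]
    exact_mod_cast hj
  have hi0 : (0 : ℝ) ≤ i * δ := by positivity
  have hiv : u + (i + 1) * δ ≤ v := by rw [← hmesh]; gcongr
  have htv : N ^ 2 * v = (N ^ 6)⁻¹ := by rw [hvN]; field_simp
  have htv1 : N ^ 2 * v ≤ 1 := by
    rw [htv]; exact inv_le_one_of_one_le₀ (one_le_pow₀ hN1)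
  have hvpow : N ^ 20 * v = N ^ 12 := by rw [hvN]; field_simp
  have htε : N ^ 2 * (1 / 2 : ℝ) ^ m = N := by
    rw [one_div, inv_pow, ← hN]; field_simp
  have hν : ∀ u' v', u ≤ u' → u' ≤ v' →
      (jumpMeasure a).real (shell u' v') ≤ 3 * a * (2 ^ 20 * N ^ 20) * (v' - u') :=
    fun u' v' h1 h2 => jumpMeasure_real_shell_le ha (hu.trans_le h1) h2 (scale_succ_rpow_le m h1)
  have hvolj : volume (Icc 0 (j * timeMesh T m)) ≤ ENNReal.ofReal T := by
    rw [Real.volume_Icc, sub_zero]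
    refine ENNReal.ofReal_le_ofReal ?_
    rw [timeMesh, ← hN]
    calc (j : ℝ) * (T / N ^ 6) ≤ N ^ 6 * (T / N ^ 6) := by gcongr
      _ = T := by field_simp
  have hsgn : ∀ σ : ℝ, |σ| = 1 → P {ω | (1 / 2 : ℝ) ^ m ≤ ∫ p in Icc 0 (j * timeMesh T m) ×ˢ
      shell (u + (i + 1) * δ) v, σ * p.2 ∂(R ω)} ≤
      ENNReal.ofReal (Real.exp (6 * a * T * 2 ^ 20 - N)) := by
    intro σ hσ
    refine (hR.measure_le_setIntegral_mul_le ha measurableSet_Icc hvolj hT.le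
      (by linarith : 0 < u + (i + 1) * δ) hv.le (t := N ^ 2) (by positivity) htv1 hσ).trans
      (ENNReal.ofReal_le_ofReal (Real.exp_le_exp.2 ?_))
    rw [htε, htv]
    have h1 : (jumpMeasure a).real (shell (u + (i + 1) * δ) v) ≤ 3 * a * 2 ^ 20 * N ^ 12 := by
      refine (hν _ _ (by linarith) hiv).trans ?_
      calc 3 * a * (2 ^ 20 * N ^ 20) * (v - (u + (i + 1) * δ))
          ≤ 3 * a * (2 ^ 20 * N ^ 20) * v := by gcongr; linarith
        _ = 3 * a * 2 ^ 20 * (N ^ 20 * v) := by ring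
        _ = _ := by rw [hvpow]
    have h2 : (N ^ 6)⁻¹ ^ 2 * (jumpMeasure a).real (shell (u + (i + 1) * δ) v) ≤
        3 * a * 2 ^ 20 := by
      calc _ ≤ (N ^ 6)⁻¹ ^ 2 * (3 * a * 2 ^ 20 * N ^ 12) := by gcongr
        _ = _ := by field_simp
    have h3 := mul_le_mul_of_nonneg_left h2 hT.le
    have h4 : 0 ≤ a * T := by positivity
    linarith
  have hshell : (jumpMeasure a).real (shell u v) ≤ 3 * a * 2 ^ 20 * N ^ 12 := by
    refine (hν _ _ le_rfl (scale_antitone (Nat.le_succ m))).trans ?_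
    calc 3 * a * (2 ^ 20 * N ^ 20) * (v - u) ≤ 3 * a * (2 ^ 20 * N ^ 20) * v := by
          gcongr; linarith
      _ = 3 * a * 2 ^ 20 * (N ^ 20 * v) := by ring
      _ = _ := by rw [hvpow]
  have htime : P {ω | (1 / 2 : ℝ) ^ m ≤ ∫ p in Ioc (j * timeMesh T m) ((j + 1) * timeMesh T m) ×ˢ
      shell u v, |p.2| ∂(R ω)} ≤ ENNReal.ofReal (Real.exp (6 * a * T * 2 ^ 20 - N)) := by
    refine (hR.measure_le_setIntegral_abs_le (L := timeMesh T m) measurableSet_Ioc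
      (by rw [Real.volume_Ioc]; apply le_of_eq; congr 1; ring)
      (by unfold timeMesh; positivity) hu hv.le (t := N ^ 2) (by positivity) htv1).trans
      (ENNReal.ofReal_le_ofReal (Real.exp_le_exp.2 ?_))
    rw [htε, htv, timeMesh, ← hN]
    refine sub_le_sub_right ?_ _
    calc T / N ^ 6 * (2 * (N ^ 6)⁻¹ * (jumpMeasure a).real (shell u v))
        ≤ T / N ^ 6 * (2 * (N ^ 6)⁻¹ * (3 * a * 2 ^ 20 * N ^ 12)) := by gcongr
      _ = 6 * a * T * 2 ^ 20 := by field_simp; ring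
  have hsize : P {ω | (1 / 2 : ℝ) ^ m ≤ ∫ p in Icc 0 T ×ˢ
      shell (u + i * δ) (u + (i + 1) * δ), |p.2| ∂(R ω)} ≤
      ENNReal.ofReal (Real.exp (6 * a * T * 2 ^ 20 - N)) := by
    refine (hR.measure_le_setIntegral_abs_le (L := T) measurableSet_Icc
      (by rw [Real.volume_Icc, sub_zero]) hT.le (by linarith : 0 < u + i * δ)
      (by linarith : 0 ≤ u + (i + 1) * δ) (t := N ^ 2)
      (by positivity) ((mul_le_mul_of_nonneg_left hiv (by positivity)).trans htv1)).trans
      (ENNReal.ofReal_le_ofReal (Real.exp_le_exp.2 ?_))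
    rw [htε]
    refine sub_le_sub_right ?_ _
    have h1 : N ^ 2 * (u + (i + 1) * δ) ≤ (N ^ 6)⁻¹ := htv ▸ by gcongr
    have hδN : N ^ 6 * δ ≤ v := by linarith
    have h2 : (jumpMeasure a).real (shell (u + i * δ) (u + (i + 1) * δ)) ≤
        3 * a * 2 ^ 20 * N ^ 6 := by
      refine (hν _ _ (by linarith) (by linarith)).trans ?_
      calc 3 * a * (2 ^ 20 * N ^ 20) * (u + (i + 1) * δ - (u + i * δ))
          = 3 * a * 2 ^ 20 * (N ^ 14 * (N ^ 6 * δ)) := by ring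
        _ ≤ 3 * a * 2 ^ 20 * (N ^ 14 * v) := by gcongr
        _ = _ := by rw [hvN]; field_simp
    have h0 : 0 ≤ N ^ 2 * (u + (i + 1) * δ) :=
      mul_nonneg (by positivity) (by linarith)
    calc T * (2 * (N ^ 2 * (u + (i + 1) * δ)) *
          (jumpMeasure a).real (shell (u + i * δ) (u + (i + 1) * δ)))
        ≤ T * (2 * (N ^ 6)⁻¹ * (3 * a * 2 ^ 20 * N ^ 6)) := by gcongr
      _ = 6 * a * T * 2 ^ 20 := by field_simp; ring
  refine (measure_union_le _ _).trans ((add_le_add (measure_union_le _ _)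
    (measure_union_le _ _)).trans ?_)
  refine (add_le_add (add_le_add (hsgn 1 (by simp)) (hsgn (-1) (by simp)))
    (add_le_add htime hsize)).trans (le_of_eq ?_)
  ring

/-- The event that one of the sums over the cells of the grid of level `m` is large. -/
def badLevel (R : Ω → Measure (ℝ × ℝ)) (T : ℝ) (m : ℕ) : Set Ω :=
  ⋃ i ∈ Finset.range ((2 ^ m) ^ 6), ⋃ j ∈ Finset.range ((2 ^ m) ^ 6 + 1), badCell R T m i j

/-- There are at most `2 N^12` cells, and `exp(-N) ≤ 13! / N^13` has one power to spare, which
leaves the summable `1/N = (1/2)^m`. -/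
lemma HasPoissonLaplace.measure_badLevel_le
    (hR : HasPoissonLaplace R (timeIntensity (jumpMeasure a)) P) (ha : 0 ≤ a) {T : ℝ}
    (hT : 0 < T) (m : ℕ) :
    P (badLevel R T m) ≤ ENNReal.ofReal
      (8 * (Nat.factorial 13 : ℝ) * Real.exp (6 * a * T * 2 ^ 20) * (1 / 2) ^ m) := by
  set E := Real.exp (6 * a * T * 2 ^ 20 - 2 ^ m) with hE
  have h1 : P (badLevel R T m) ≤ ∑ i ∈ Finset.range ((2 ^ m) ^ 6),
      ∑ j ∈ Finset.range ((2 ^ m) ^ 6 + 1), 4 * ENNReal.ofReal E :=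
    (measure_biUnion_finset_le _ _).trans <| Finset.sum_le_sum fun i hi =>
      (measure_biUnion_finset_le _ _).trans <| Finset.sum_le_sum fun j hj =>
        hR.measure_badCell_le ha hT m i j (Finset.mem_range.1 hi)
          (Nat.lt_succ_iff.1 (Finset.mem_range.1 hj))
  refine h1.trans ?_
  simp only [Finset.sum_const, Finset.card_range, nsmul_eq_mul]
  rw [show (4 : ℝ≥0∞) = ENNReal.ofReal 4 by simp, ← ENNReal.ofReal_natCast,
    ← ENNReal.ofReal_natCast, ← ENNReal.ofReal_mul (by norm_num),
    ← ENNReal.ofReal_mul (by positivity), ← ENNReal.ofReal_mul (by positivity)]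
  refine ENNReal.ofReal_le_ofReal ?_
  push_cast
  set N : ℝ := (2 : ℝ) ^ m with hN
  have hN1 : 1 ≤ N := one_le_pow₀ one_le_two
  have hN0 : 0 < N := one_pos.trans_le hN1
  have h2 := Real.pow_div_factorial_le_exp N hN0.le 13
  have hf : (0 : ℝ) < (Nat.factorial 13 : ℝ) := by positivity
  have h3 : Real.exp (-N) ≤ (Nat.factorial 13 : ℝ) / N ^ 13 := by
    rw [Real.exp_neg, ← inv_div]
    gcongr
  have h4 : N ^ 6 + 1 ≤ 2 * N ^ 6 := by linarith [one_le_pow₀ (n := 6) hN1]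
  rw [hE, sub_eq_add_neg, Real.exp_add, one_div, inv_pow, ← hN]
  calc N ^ 6 * ((N ^ 6 + 1) * (4 * (Real.exp (6 * a * T * 2 ^ 20) * Real.exp (-N))))
      ≤ N ^ 6 * ((2 * N ^ 6) * (4 * (Real.exp (6 * a * T * 2 ^ 20) *
          ((Nat.factorial 13 : ℝ) / N ^ 13)))) := by gcongr
    _ = 8 * (Nat.factorial 13 : ℝ) * Real.exp (6 * a * T * 2 ^ 20) * N⁻¹ := by
        field_simp
        ring

lemma HasPoissonLaplace.ae_eventually_notMem_badLevel
    (hR : HasPoissonLaplace R (timeIntensity (jumpMeasure a)) P) (ha : 0 ≤ a) {T : ℝ}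
    (hT : 0 < T) : ∀ᵐ ω ∂P, ∀ᶠ m in atTop, ω ∉ badLevel R T m := by
  refine ae_eventually_notMem (ne_top_of_le_ne_top ?_
    (ENNReal.tsum_le_tsum fun m => hR.measure_badLevel_le ha hT m))
  exact ((summable_geometric_two).mul_left _).tsum_ofReal_ne_top

lemma TameJumps.abs_jumpSum_sub_le_of_notMem_badLevel {Ω : Type*} {R : Ω → Measure (ℝ × ℝ)} {ω : Ω}
    (h : TameJumps (R ω)) {T : ℝ}
    (hT : 0 < T) {m : ℕ} (hω : ω ∉ badLevel R T m) {θ c : ℝ} (hθ : 0 ≤ θ) (hθT : θ ≤ T)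
    (hc : scale (m + 1) ≤ c) (hcm : c < scale m) :
    |jumpSum (R ω) c θ - jumpSum (R ω) (scale m) θ| ≤ 3 * (1 / 2) ^ m := by
  have hcell : ∀ i < (2 ^ m) ^ 6, ∀ j ≤ (2 ^ m) ^ 6, ω ∉ badCell R T m i j := by
    intro i hi j hj hmem
    refine hω ?_
    simp only [badLevel, mem_iUnion, Finset.mem_range]
    exact ⟨i, hi, j, Nat.lt_succ_iff.2 hj, hmem⟩
  simp only [badCell, mem_union, mem_ofPred_eq, not_or, not_le, integral_neg, one_mul,
    neg_mul] at hcell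
  have hTmesh : (((2 ^ m) ^ 6 : ℕ) : ℝ) * timeMesh T m = T := by
    unfold timeMesh
    push_cast
    field_simp
  rw [h.jumpSum_sub ((scale_pos _).trans_le hc) hcm.le]
  refine h.abs_setIntegral_le_of_grid (n := (2 ^ m) ^ 6) (scale_pos _)
    (τ := timeMesh T m) (by unfold timeMesh; positivity)
    (sizeMesh_pos m) (scale_succ_add_mesh m) (fun i hi j hj => ?_) (fun j hj => ?_)
    (fun i hi => ?_) hθ (hTmesh.symm ▸ hθT) hc hcm
  · obtain ⟨⟨h1, h2⟩, -⟩ := hcell i hi j hj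
    exact abs_le.2 ⟨by linarith, h1.le⟩
  -- The slab sum does not involve `i`, nor the thin-shell sum below `j`; index `0` serves for both.
  · exact (hcell 0 (by positivity) j hj).2.1.le
  · rw [hTmesh]
    exact (hcell i hi 0 (Nat.zero_le _)).2.2.le

/-- Almost surely, the compensated sums of jumps are uniformly Cauchy as the truncation level
tends to zero. -/
lemma HasPoissonLaplace.ae_uniformCauchy
    (hR : HasPoissonLaplace R (timeIntensity (jumpMeasure a)) P) (ha : 0 ≤ a)
    (htame : ∀ᵐ ω ∂P, TameJumps (R ω)) {T : ℝ} (hT : 0 < T) :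
    ∀ᵐ ω ∂P, ∀ ε > 0, ∃ c₀ > 0, ∀ θ, 0 ≤ θ → θ ≤ T → ∀ c, 0 < c → c ≤ c₀ →
      |jumpSum (R ω) c θ - jumpSum (R ω) c₀ θ| ≤ ε := by
  filter_upwards [htame, hR.ae_eventually_notMem_badLevel ha hT] with ω h hω ε hε
  obtain ⟨m₀, hm₀⟩ := eventually_atTop.1 hω
  have hlim : Tendsto (fun m : ℕ => 6 * (1 / 2 : ℝ) ^ m) atTop (𝓝 0) := by
    simpa using! (tendsto_pow_atTop_nhds_zero_of_lt_one (r := (1 / 2 : ℝ)) (by norm_num)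
      (by norm_num)).const_mul 6
  obtain ⟨m, hmε, hm⟩ := ((hlim.eventually (gt_mem_nhds hε)).and (eventually_ge_atTop m₀)).exists
  -- The level `m` depends on `ε` and `ω` only; the number `k` of shells crossed depends on `c`, but
  -- the geometric bound does not.
  refine ⟨scale m, scale_pos m, fun θ hθ hθT c hc hcm => ?_⟩
  obtain ⟨k, hk⟩ := ((tendsto_scale.comp (tendsto_add_atTop_nat m)).eventually
    (gt_mem_nhds hc)).exists
  have := abs_sub_le_of_shells (f := fun c => jumpSum (R ω) c θ) (m₀ := m₀)
    (fun n hn c hc hcn => h.abs_jumpSum_sub_le_of_notMem_badLevel hT (hm₀ n hn) hθ hθT hc hcn)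
    hm k c (by rw [add_comm]; exact le_of_lt hk) hcm scale_antitone
  have h2 : (0 : ℝ) ≤ 6 * (1 / 2) ^ (m + k) := by positivity
  linarith

end UniformCauchy

end

/-! ### Almost sure finiteness of the truncated sums. -/

section Tame

variable {Ω : Type*} [MeasurableSpace Ω] {P : Measure Ω}

/-- The sets where `|f| > n` inside `A` decrease to the empty set, so their measures tend to `0`;
being integers, they are eventually equal to `0`. Hence `f` is essentially bounded on `A`. -/
lemma integrableOn_of_integer_valued {α : Type*} [MeasurableSpace α] {μ : Measure α}
    (hμ : ∀ B, MeasurableSet B → μ B = ∞ ∨ ∃ n : ℕ, μ B = (n : ℝ≥0∞)) {A : Set α}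
    (hA : MeasurableSet A) (hfin : μ A < ∞) {f : α → ℝ} (hf : Measurable f) :
    IntegrableOn f A μ := by
  have hms : ∀ n : ℕ, MeasurableSet (A ∩ {x | (n : ℝ) < |f x|}) := fun n =>
    hA.inter (measurableSet_lt measurable_const hf.abs)
  have hlim := tendsto_measure_iInter_atTop (μ := μ) (s := fun n : ℕ => A ∩ {x | (n : ℝ) < |f x|})
    (fun n => (hms n).nullMeasurableSet)
    (fun m n hmn x hx => ⟨hx.1, show (m : ℝ) < |f x| from
      lt_of_le_of_lt (Nat.cast_le.2 hmn) hx.2⟩)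
    ⟨0, (lt_of_le_of_lt (measure_mono inter_subset_left) hfin).ne⟩
  have hempty : ⋂ n : ℕ, A ∩ {x | (n : ℝ) < |f x|} = ∅ := by
    refine eq_empty_of_forall_notMem fun x hx => ?_
    obtain ⟨n, hn⟩ := exists_nat_ge |f x|
    exact absurd (mem_iInter.1 hx n).2 (not_lt.2 hn)
  rw [hempty, measure_empty] at hlim
  obtain ⟨n, hn⟩ := (hlim.eventually (gt_mem_nhds one_pos)).exists
  rw [Function.comp_apply] at hn
  have hzero : μ (A ∩ {x | (n : ℝ) < |f x|}) = 0 := by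
    rcases hμ _ (hms n) with h | ⟨k, hk⟩
    · rw [h] at hn; simp at hn
    · rw [hk] at hn ⊢
      have : k < 1 := by exact_mod_cast hn
      simp [Nat.lt_one_iff.1 this]
  refine Measure.integrableOn_of_bounded (M := n) hfin.ne hf.aestronglyMeasurable ?_
  rw [ae_restrict_iff' hA, ae_iff]
  refine measure_mono_null (fun x hx => ?_) hzero
  simp only [mem_ofPred_eq, not_forall, not_le] at hx
  exact ⟨hx.1, hx.2⟩

lemma IsPoissonPointProcess.ae_eq_zero {α : Type*} [MeasurableSpace α] {R : Ω → Measure α}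
    {Λ : Measure α} (hR : IsPoissonPointProcess R Λ P) {B : Set α} (hB : MeasurableSet B)
    (hΛ : Λ B = 0) : ∀ᵐ ω ∂P, R ω B = 0 := by
  have hm : MeasurableSet {u : ℝ≥0∞ | u = 0} := measurableSet_singleton 0
  rw [(hR.hasLaw B hB (by simp [hΛ])).ae_iff (p := fun u => u = 0) (measurableSet_setOfPred.1 hm),
    ae_map_iff (by fun_prop) hm, hΛ, ae_iff_of_countable]
  intro n hn
  rw [poissonMeasure_singleton] at hn
  by_contra h
  have h0 : n ≠ 0 := by exact_mod_cast h
  simp [h0] at hn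

/-- Countably many boxes absorb all pairs `(c, θ)`, so a single null set suffices. -/
lemma IsPoissonPointProcess.ae_tameJumps {R : Ω → Measure (ℝ × ℝ)} {ν : Measure ℝ} [SFinite ν]
    (hR : IsPoissonPointProcess R (timeIntensity ν) P)
    (hν : ∀ c : ℝ, 0 < c → ν (bigJumps c) < ∞) : ∀ᵐ ω ∂P, TameJumps (R ω) := by
  have h1 : ∀ᵐ ω ∂P, ∀ n : ℕ, R ω (Icc 0 (n : ℝ) ×ˢ bigJumps (1 / ((n : ℝ) + 1))) ≠ ∞ := by
    rw [ae_all_iff]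
    intro n
    exact hR.ae_ne_top (measurableSet_Icc.prod (measurableSet_bigJumps _))
      (timeIntensity_prod_lt_top (by simp) (hν _ (by positivity)).ne).ne
  filter_upwards [h1] with ω hω
  have hlt : ∀ c : ℝ, 0 < c → ∀ θ : ℝ, R ω (Icc 0 θ ×ˢ bigJumps c) < ∞ := by
    intro c hc θ
    obtain ⟨n, hn⟩ := exists_nat_ge (max θ (1 / c))
    refine lt_of_le_of_lt (measure_mono (prod_mono
      (Icc_subset_Icc_right ((le_max_left _ _).trans hn)) fun x hx => ?_)) (hω n).lt_top
    have hn' : 1 / c ≤ n := (le_max_right _ _).trans hn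
    refine lt_of_le_of_lt ?_ (show c < |x| from hx)
    rw [div_le_iff₀ hc] at hn'
    rw [div_le_iff₀ (by positivity)]
    nlinarith
  exact ⟨hlt, fun c hc θ => integrableOn_of_integer_valued (hR.integer_valued ω)
    (measurableSet_Icc.prod (measurableSet_bigJumps c)) (hlt c hc θ) measurable_snd⟩

lemma TameJumps.add {μ ν : Measure (ℝ × ℝ)} (hμ : TameJumps μ) (hν : TameJumps ν) :
    TameJumps (μ + ν) where
  lt_top c hc θ := by
    rw [Measure.add_apply]
    exact ENNReal.add_lt_top.2 ⟨hμ.lt_top c hc θ, hν.lt_top c hc θ⟩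
  integrableOn c hc θ := (hμ.integrableOn c hc θ).add_measure (hν.integrableOn c hc θ)

lemma Ioi_subset_bigJumps (c : ℝ) : Ioi c ⊆ bigJumps c := fun x hx =>
  show c < |x| from lt_abs.2 (Or.inl hx)

lemma Iio_neg_subset_bigJumps (c : ℝ) : Iio (-c) ⊆ bigJumps c :=
  fun x hx => show c < |x| from lt_abs.2 (Or.inr (lt_neg_of_lt_neg hx))

lemma setIntegral_prod_bigJumps_eq {μ : Measure (ℝ × ℝ)} {c : ℝ} {I S N : Set ℝ}
    (hN : μ (univ ×ˢ N) = 0) (hS : S ⊆ bigJumps c) (hcover : bigJumps c ⊆ S ∪ N) :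
    ∫ p in I ×ˢ S, p.2 ∂μ = ∫ p in I ×ˢ bigJumps c, p.2 ∂μ := by
  refine setIntegral_congr_set ?_
  refine (LE.le.eventuallyLE (prod_mono subset_rfl hS)).antisymm ?_
  rw [ae_le_set]
  refine measure_mono_null (fun p hp => ?_) hN
  rcases hcover hp.1.2 with h | h
  · exact absurd ⟨hp.1.1, h⟩ hp.2
  · exact ⟨mem_univ _, h⟩

/-- The regularity of the pair of point measures that is needed for the construction of `V`. -/
structure TamePair (μ ν : Measure (ℝ × ℝ)) : Prop where
  tame_left : TameJumps μ
  tame_right : TameJumps ν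
  left_null : μ (univ ×ˢ Iic (0 : ℝ)) = 0
  right_null : ν (univ ×ˢ Ici (0 : ℝ)) = 0

lemma TamePair.truncV_eq {Ω : Type*} {Rp Rm : Ω → Measure (ℝ × ℝ)} {ω : Ω} (h : TamePair (Rp ω) (Rm ω))
    {c : ℝ} (hc : 0 < c) (θ : ℝ≥0) : truncV Rp Rm c θ ω = jumpSum (Rp ω + Rm ω) c θ := by
  rw [truncV, jumpSum, Measure.restrict_add, integral_add_measure
    (h.tame_left.integrableOn c hc θ) (h.tame_right.integrableOn c hc θ),
    setIntegral_prod_bigJumps_eq h.left_null (Ioi_subset_bigJumps c),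
    setIntegral_prod_bigJumps_eq h.right_null (Iio_neg_subset_bigJumps c)]
  · intro x hx
    rcases lt_abs.1 (show c < |x| from hx) with h | h
    · exact Or.inr (hc.trans h).le
    · exact Or.inl (by simp only [mem_Iio]; linarith)
  · intro x hx
    rcases lt_abs.1 (show c < |x| from hx) with h | h
    · exact Or.inl h
    · exact Or.inr (by simp only [mem_Iic]; linarith)

lemma ae_tamePair {a : ℝ} {Rp Rm : Ω → Measure (ℝ × ℝ)}
    (hRp : IsPoissonPointProcess Rp (timeIntensity (nuPlus a)) P)
    (hRm : IsPoissonPointProcess Rm (timeIntensity (nuMinus a)) P) :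
    ∀ᵐ ω ∂P, TamePair (Rp ω) (Rm ω) := by
  have hp : nuPlus a ≤ jumpMeasure a := by
    rw [← nuPlus_add_nuMinus]; exact Measure.le_add_right le_rfl
  have hm : nuMinus a ≤ jumpMeasure a := by
    rw [← nuPlus_add_nuMinus]; exact Measure.le_add_left le_rfl
  have hp0 : nuPlus a (Iic 0) = 0 := by
    rw [nuPlus]
    refine withDensity_absolutelyContinuous _ _ ?_
    rw [Measure.restrict_apply measurableSet_Iic, Iic_inter_Ioi, Ioc_self, measure_empty]
  have hm0 : nuMinus a (Ici 0) = 0 := by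
    rw [nuMinus]
    refine withDensity_absolutelyContinuous _ _ ?_
    rw [Measure.restrict_apply measurableSet_Ici, Ici_inter_Iio, Ico_self, measure_empty]
  filter_upwards [hRp.ae_tameJumps fun c hc => (hp _).trans_lt (jumpMeasure_abs_gt_lt_top a hc),
    hRm.ae_tameJumps fun c hc => (hm _).trans_lt (jumpMeasure_abs_gt_lt_top a hc),
    hRp.ae_eq_zero (B := univ ×ˢ Iic (0 : ℝ)) (MeasurableSet.univ.prod measurableSet_Iic)
      (by rw [timeIntensity, Measure.prod_prod, hp0, mul_zero]),
    hRm.ae_eq_zero (B := univ ×ˢ Ici (0 : ℝ)) (MeasurableSet.univ.prod measurableSet_Ici)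
      (by rw [timeIntensity, Measure.prod_prod, hm0, mul_zero])] with ω h1 h2 h3 h4
  exact ⟨h1, h2, h3, h4⟩

end Tame

/-! ### Càdlàg paths and the pathwise limit. -/

noncomputable section

section Paths

lemma IsCadlag.of_tendstoUniformlyOn {ι : Type*} {p : Filter ι} [p.NeBot] {F : ι → ℝ≥0 → ℝ}
    {f : ℝ≥0 → ℝ} (hF : ∀ᶠ c in p, IsCadlag (F c))
    (hlim : ∀ T : ℝ≥0, TendstoUniformlyOn F f p (Icc 0 T)) : IsCadlag f := by
  intro t
  have hclose : ∀ ε > 0, ∃ c, IsCadlag (F c) ∧ ∀ x ∈ Icc 0 (t + 1), dist (f x) (F c x) < ε :=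
    fun ε hε => (hF.and (Metric.tendstoUniformlyOn_iff.1 (hlim (t + 1)) ε hε)).exists
  have hIcc : ∀ᶠ x in 𝓝 t, x ∈ Icc 0 (t + 1) :=
    (eventually_le_nhds (lt_add_one t)).mono fun x hx => ⟨zero_le, hx⟩
  refine ⟨?_, ?_⟩
  · rw [ContinuousWithinAt, Metric.tendsto_nhds]
    intro ε hε
    obtain ⟨c, hc, hfc⟩ := hclose (ε / 3) (by positivity)
    filter_upwards [Metric.tendsto_nhds.1 (hc t).1 (ε / 3) (by positivity),
      nhdsWithin_le_nhds hIcc] with x hx hx'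
    have h1 := hfc x hx'
    have h2 := hfc t ⟨zero_le, by simp⟩
    rw [Real.dist_eq, abs_lt] at *
    constructor <;> linarith [h1.1, h1.2, h2.1, h2.2, hx.1, hx.2]
  -- At `t = 0` the left neighbourhood filter is trivial and any value is a left limit.
  · rcases eq_or_ne (𝓝[<] t) ⊥ with hbot | hbot
    · exact ⟨0, by simp [hbot]⟩
    have : (𝓝[<] t).NeBot := ⟨hbot⟩
    refine cauchy_map_iff_exists_tendsto.1 (Metric.cauchy_iff.2 ⟨inferInstance, fun ε hε => ?_⟩)
    obtain ⟨c, hc, hfc⟩ := hclose (ε / 4) (by positivity)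
    obtain ⟨l, hl⟩ := (hc t).2
    have hev : ∀ᶠ x in 𝓝[<] t, dist (f x) l < ε / 2 := by
      filter_upwards [Metric.tendsto_nhds.1 hl (ε / 4) (by positivity),
        nhdsWithin_le_nhds hIcc] with x hx hx'
      have h1 := hfc x hx'
      linarith [dist_triangle (f x) (F c x) l]
    refine ⟨f '' {x | dist (f x) l < ε / 2}, image_mem_map hev, ?_⟩
    rintro _ ⟨x, hx, rfl⟩ _ ⟨y, hy, rfl⟩
    have hx' : dist (f x) l < ε / 2 := hx
    have hy' : dist (f y) l < ε / 2 := hy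
    linarith [dist_triangle_right (f x) (f y) l]

lemma TameJumps.isCadlag_jumpSum {μ : Measure (ℝ × ℝ)} (h : TameJumps μ) {c : ℝ} (hc : 0 < c) :
    IsCadlag fun θ : ℝ≥0 => jumpSum μ c θ := by
  intro t
  have hm : ∀ I : Set ℝ, MeasurableSet I → MeasurableSet (I ×ˢ bigJumps c) :=
    fun I hI => hI.prod (measurableSet_bigJumps c)
  have heq : ∀ θ : ℝ≥0, jumpSum μ c θ =
      ∫ p, (Icc 0 (θ : ℝ) ×ˢ bigJumps c).indicator (fun p : ℝ × ℝ => p.2) p ∂μ :=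
    fun θ => (integral_indicator (hm _ measurableSet_Icc)).symm
  -- One dominated convergence for both one-sided limits: `J` is the pointwise limit of `[0, θ]`
  -- along `l`, namely `[0, t]` from the right and `[0, t)` from the left.
  have key : ∀ (l : Filter ℝ≥0) [l.IsCountablyGenerated] (J : Set ℝ), l ≤ 𝓝 t →
      (∀ s : ℝ, 0 ≤ s → ∀ᶠ θ : ℝ≥0 in l, (s ≤ θ ↔ s ∈ J)) → J ⊆ Ici 0 →
      Tendsto (fun θ : ℝ≥0 => jumpSum μ c θ) l
        (𝓝 (∫ p, (J ×ˢ bigJumps c).indicator (fun p : ℝ × ℝ => p.2) p ∂μ)) := by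
    intro l _ J hl hJ hJ0
    simp only [heq]
    refine tendsto_integral_filter_of_dominated_convergence
      ((Icc 0 ((t : ℝ) + 1) ×ˢ bigJumps c).indicator fun p : ℝ × ℝ => |p.2|)
      (Eventually.of_forall fun θ =>
        (measurable_snd.indicator (hm _ measurableSet_Icc)).aestronglyMeasurable)
      ?_ ((integrable_indicator_iff (hm _ measurableSet_Icc)).2 (h.integrableOn c hc _).abs) ?_
    · filter_upwards [hl (eventually_le_nhds (lt_add_one t))] with θ hθ
      refine ae_of_all _ fun p => ?_
      have hθ' : (θ : ℝ) ≤ t + 1 := by exact_mod_cast hθ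
      rw [norm_indicator_eq_indicator_norm]
      exact indicator_le_indicator_of_subset (prod_mono (Icc_subset_Icc_right hθ') subset_rfl)
        (fun p => abs_nonneg _) p
    · refine ae_of_all _ fun p => ?_
      by_cases hp0 : 0 ≤ p.1
      · refine (tendsto_const_nhds).congr' ?_
        filter_upwards [hJ p.1 hp0] with θ hθ
        have hiff : p ∈ J ×ˢ bigJumps c ↔ p ∈ Icc 0 (θ : ℝ) ×ˢ bigJumps c := by
          simp only [mem_prod, mem_Icc, hp0, true_and, hθ]
        by_cases hp : p ∈ J ×ˢ bigJumps c
        · rw [indicator_of_mem hp, indicator_of_mem (hiff.1 hp)]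
        · rw [indicator_of_notMem hp, indicator_of_notMem (mt hiff.2 hp)]
      · rw [indicator_of_notMem fun hp => hp0 (hJ0 hp.1)]
        refine tendsto_const_nhds.congr fun θ => ?_
        rw [indicator_of_notMem fun hp => hp0 hp.1.1]
  refine ⟨?_, _, key (𝓝[<] t) (Ico 0 (t : ℝ)) nhdsWithin_le_nhds (fun s hs => ?_)
    fun x hx => hx.1⟩
  · rw [ContinuousWithinAt, heq t]
    refine key (𝓝[≥] t) (Icc 0 (t : ℝ)) nhdsWithin_le_nhds (fun s hs => ?_) fun x hx => hx.1
    rcases le_or_gt s t with hst | hst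
    · filter_upwards [self_mem_nhdsWithin] with θ hθ
      have hθ' : (t : ℝ) ≤ θ := by exact_mod_cast hθ
      simp [hs, hst, hst.trans hθ']
    · have hst' : t < ⟨s, hs⟩ := hst
      filter_upwards [nhdsWithin_le_nhds (gt_mem_nhds hst')] with θ hθ
      have hθ' : (θ : ℝ) < s := hθ
      simp [hst.not_ge, hθ'.not_ge]
  · rcases lt_or_ge s t with hst | hst
    · have hst' : ⟨s, hs⟩ < t := hst
      filter_upwards [nhdsWithin_le_nhds (lt_mem_nhds hst')] with θ hθ
      have hθ' : s < (θ : ℝ) := hθ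
      simp [hs, hst, hθ'.le]
    · filter_upwards [self_mem_nhdsWithin] with θ hθ
      have hθ' : (θ : ℝ) < t := by exact_mod_cast hθ
      simp [hst.not_gt, (hθ'.trans_le hst).not_ge]

/-- The sums of the jumps larger than `c` form a uniform Cauchy family on compact time intervals
as `c ↓ 0`. -/
def UniformCauchyJumps (μ : Measure (ℝ × ℝ)) : Prop :=
  ∀ T : ℕ, ∀ ε > 0, ∃ c₀ > 0, ∀ θ : ℝ, 0 ≤ θ → θ ≤ T + 1 → ∀ c, 0 < c → c ≤ c₀ →
      |jumpSum μ c θ - jumpSum μ c₀ θ| ≤ ε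

/-- The sum of all jumps up to time `θ`, as an improper sum with symmetric cut-off. -/
def jumpLim (μ : Measure (ℝ × ℝ)) (θ : ℝ≥0) : ℝ :=
  limUnder (𝓝[>] (0 : ℝ)) fun c => jumpSum μ c θ

variable {μ : Measure (ℝ × ℝ)}

lemma UniformCauchyJumps.uniformCauchySeqOn (h : UniformCauchyJumps μ) (T : ℝ≥0) :
    UniformCauchySeqOn (fun (c : ℝ) (θ : ℝ≥0) => jumpSum μ c θ) (𝓝[>] 0) (Icc 0 T) := by
  intro u hu
  obtain ⟨ε, hε, hεu⟩ := Metric.mem_uniformity_dist.1 hu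
  obtain ⟨n, hn⟩ := exists_nat_ge (T : ℝ)
  obtain ⟨c₀, hc₀, hc⟩ := h n (ε / 3) (by positivity)
  have hev : ∀ᶠ c in 𝓝[>] (0 : ℝ), c ∈ Ioc 0 c₀ := Ioc_mem_nhdsGT hc₀
  filter_upwards [hev.prod_mk hev] with c hcc θ hθ
  have hθT : (θ : ℝ) ≤ n + 1 := by
    have : (θ : ℝ) ≤ T := by exact_mod_cast hθ.2
    linarith
  have h1 := hc θ θ.2 hθT c.1 hcc.1.1 hcc.1.2
  have h2 := hc θ θ.2 hθT c.2 hcc.2.1 hcc.2.2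
  refine hεu ?_
  rw [Real.dist_eq, abs_lt]
  rw [abs_le] at h1 h2
  constructor <;> linarith [h1.1, h1.2, h2.1, h2.2]

lemma UniformCauchyJumps.tendsto (h : UniformCauchyJumps μ) (θ : ℝ≥0) :
    Tendsto (fun c => jumpSum μ c θ) (𝓝[>] 0) (𝓝 (jumpLim μ θ)) :=
  ((h.uniformCauchySeqOn θ).cauchy_map ⟨zero_le, le_rfl⟩).le_nhds_lim

lemma UniformCauchyJumps.tendstoUniformlyOn (h : UniformCauchyJumps μ) (T : ℝ≥0) :
    TendstoUniformlyOn (fun (c : ℝ) (θ : ℝ≥0) => jumpSum μ c θ) (jumpLim μ) (𝓝[>] 0)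
      (Icc 0 T) :=
  (h.uniformCauchySeqOn T).tendstoUniformlyOn_of_tendsto fun θ _ => h.tendsto θ

lemma UniformCauchyJumps.isCadlag (h : UniformCauchyJumps μ) (ht : TameJumps μ) :
    IsCadlag (jumpLim μ) :=
  IsCadlag.of_tendstoUniformlyOn (p := 𝓝[>] (0 : ℝ))
    (by filter_upwards [self_mem_nhdsWithin] with c hc using ht.isCadlag_jumpSum hc)
    h.tendstoUniformlyOn

/-- `limUnder` depends only on the germ at `0+`, so agreement of the truncations for `c > 0` is
enough, whether or not the limit exists. -/
lemma TamePair.V_eq {Ω : Type*} {Rp Rm : Ω → Measure (ℝ × ℝ)} {ω : Ω}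
    (h : TamePair (Rp ω) (Rm ω)) (θ : ℝ≥0) : V Rp Rm θ ω = jumpLim (Rp ω + Rm ω) θ := by
  rw [V, jumpLim, limUnder, limUnder]
  congr 1
  refine Filter.map_congr ?_
  filter_upwards [self_mem_nhdsWithin] with c hc
  exact h.truncV_eq hc θ

end Paths

end

/-! ### Joint characteristic functions. -/

noncomputable section

section CharacteristicFunctional

variable {Ω : Type*} [MeasurableSpace Ω] {P : Measure Ω}
  {R : Ω → Measure (ℝ × ℝ)} {a : ℝ}

lemma integrable_shell_of_abs_le {a u v : ℝ} (hu : 0 < u) {f : ℝ → ℝ} (hf : Measurable f) {M : ℝ}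
    (hM : ∀ x, |f x| ≤ M) (hsupp : ∀ x ∉ shell u v, f x = 0) : Integrable f (jumpMeasure a) :=
  integrable_of_bounded_of_support hf.aestronglyMeasurable hM
    (jumpMeasure_shell_lt_top a hu v).ne hsupp

/-- The sine part is odd and drops out, so the exponent is real. -/
lemma integral_cexp_shell_sub_one (ha : 0 ≤ a) {u : ℝ} (hu : 0 < u) (v y : ℝ) :
    ∫ x, (Complex.exp (((y * (shell u v).indicator id x : ℝ) : ℂ) * Complex.I) - 1)
      ∂(jumpMeasure a) = ((-∫ x in shell u v, (1 - Real.cos (y * x)) ∂(jumpMeasure a) : ℝ) : ℂ) := by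
  have hS := measurableSet_shell u v
  have hind : Measurable ((shell u v).indicator (id : ℝ → ℝ)) := measurable_id.indicator hS
  have hcos : Integrable (fun x => Real.cos (y * (shell u v).indicator id x) - 1)
      (jumpMeasure a) :=
    integrable_shell_of_abs_le hu (by fun_prop) (M := 2) (fun x => by
      rw [abs_le]
      constructor <;> linarith [Real.neg_one_le_cos (y * (shell u v).indicator id x),
        Real.cos_le_one (y * (shell u v).indicator id x)]) (v := v)
      (fun x hx => by simp [indicator_of_notMem hx])
  have hsin : Integrable (fun x => Real.sin (y * (shell u v).indicator id x)) (jumpMeasure a) :=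
    integrable_shell_of_abs_le hu (by fun_prop) (M := 1) (fun x => Real.abs_sin_le_one _) (v := v)
      (fun x hx => by simp [indicator_of_notMem hx])
  have hodd : ∫ x, Real.sin (y * (shell u v).indicator id x) ∂(jumpMeasure a) = 0 := by
    refine integral_jumpMeasure_of_odd ha fun x => ?_
    by_cases hx : x ∈ shell u v
    · rw [indicator_of_mem hx, indicator_of_mem (neg_mem_shell.2 hx)]; simp
    · rw [indicator_of_notMem hx, indicator_of_notMem (mt neg_mem_shell.1 hx)]; simp
  have hsplit : ∀ x, Complex.exp (((y * (shell u v).indicator id x : ℝ) : ℂ) * Complex.I) - 1 =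
      ((Real.cos (y * (shell u v).indicator id x) - 1 : ℝ) : ℂ) +
        ((Real.sin (y * (shell u v).indicator id x) : ℝ) : ℂ) * Complex.I := by
    intro x
    rw [Complex.exp_mul_I]
    push_cast
    ring
  simp_rw [hsplit]
  rw [integral_add hcos.ofReal (hsin.ofReal.mul_const _), integral_mul_const,
    integral_complex_ofReal, integral_complex_ofReal, hodd, Complex.ofReal_zero, zero_mul, add_zero,
    Complex.ofReal_inj, ← integral_indicator hS, ← integral_neg]
  refine integral_congr_ae (ae_of_all _ fun x => ?_)
  by_cases hx : x ∈ shell u v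
  · simp [indicator_of_mem hx]
  · simp [indicator_of_notMem hx]

/-- The characteristic function of the integral of `h(s) x` over the jumps in a shell. -/
lemma HasPoissonLaplace.integral_cexp_shell
    (hR : HasPoissonLaplace R (timeIntensity (jumpMeasure a)) P) (ha : 0 ≤ a) {h : ℝ → ℝ}
    (hh : Measurable h) {M T : ℝ} (hM : ∀ s, |h s| ≤ M) (hT : ∀ s ∉ Icc 0 T, h s = 0) {u v : ℝ}
    (hu : 0 < u) (hv : 0 ≤ v) :
    AEStronglyMeasurable
      (fun ω => ∫ p : ℝ × ℝ, h p.1 * (shell u v).indicator id p.2 ∂(R ω)) P ∧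
    ∫ ω, Complex.exp (((∫ p : ℝ × ℝ, h p.1 * (shell u v).indicator id p.2 ∂(R ω) : ℝ) : ℂ) *
      Complex.I) ∂P =
    Complex.exp ((-∫ s in Ici 0, ∫ x in shell u v, (1 - Real.cos (h s * x)) ∂(jumpMeasure a) :
      ℝ) : ℂ) := by
  have hS := measurableSet_shell u v
  have hind : Measurable ((shell u v).indicator (id : ℝ → ℝ)) := measurable_id.indicator hS
  have hfin : timeIntensity (jumpMeasure a) (Icc 0 T ×ˢ shell u v) ≠ ∞ :=
    (timeIntensity_prod_lt_top (by simp) (jumpMeasure_shell_lt_top a hu v).ne).ne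
  have hmeas : MeasurableSet (Icc 0 T ×ˢ shell u v) := measurableSet_Icc.prod hS
  have hM0 : 0 ≤ M := (abs_nonneg _).trans (hM 0)
  have hbound : ∀ p : ℝ × ℝ, |h p.1 * (shell u v).indicator id p.2| ≤ M * v := by
    intro p
    rw [abs_mul]
    refine mul_le_mul (hM _) ?_ (abs_nonneg _) hM0
    by_cases hx : p.2 ∈ shell u v
    · rw [indicator_of_mem hx]; exact hx.2
    · rw [indicator_of_notMem hx, abs_zero]; exact hv
  have hsupp : ∀ p : ℝ × ℝ, p ∉ Icc 0 T ×ˢ shell u v →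
      h p.1 * (shell u v).indicator id p.2 = 0 := by
    intro p hp
    by_cases hx : p.2 ∈ shell u v
    · rw [hT p.1 fun hs => hp ⟨hs, hx⟩, zero_mul]
    · rw [indicator_of_notMem hx, mul_zero]
  have hgm : Measurable fun p : ℝ × ℝ => h p.1 * (shell u v).indicator id p.2 :=
    (hh.comp measurable_fst).mul (hind.comp measurable_snd)
  obtain ⟨h1, -, -⟩ := hR.integral_cexp
    (g := fun p => ((h p.1 * (shell u v).indicator id p.2 : ℝ) : ℂ))
    (Complex.measurable_ofReal.comp hgm) (M := M * v)
    (fun p => by rw [Complex.norm_real]; exact hbound p) hmeas hfin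
    (fun p hp => by rw [hsupp p hp, Complex.ofReal_zero])
  obtain ⟨-, -, h2⟩ := hR.integral_cexp
    (g := fun p => ((h p.1 * (shell u v).indicator id p.2 : ℝ) : ℂ) * Complex.I)
    ((Complex.measurable_ofReal.comp hgm).mul_const _) (M := M * v)
    (fun p => by rw [norm_mul, Complex.norm_real, Complex.norm_I, mul_one]; exact hbound p)
    hmeas hfin (fun p hp => by rw [hsupp p hp, Complex.ofReal_zero, zero_mul])
  simp_rw [integral_complex_ofReal] at h1
  simp_rw [integral_mul_const, integral_complex_ofReal] at h2
  refine ⟨h1.re, h2.trans ?_⟩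
  congr 1
  have hint : Integrable (fun p : ℝ × ℝ =>
      Complex.exp (((h p.1 * (shell u v).indicator id p.2 : ℝ) : ℂ) * Complex.I) - 1)
      (timeIntensity (jumpMeasure a)) := by
    refine integrable_of_bounded_of_support (M := 2) ?_ (fun p => ?_) hfin (fun p hp => ?_)
    · exact ((Complex.measurable_exp.comp
        ((Complex.measurable_ofReal.comp hgm).mul_const _)).sub_const 1).aestronglyMeasurable
    · refine (norm_sub_le _ _).trans ?_
      rw [Complex.norm_exp_ofReal_mul_I, norm_one]
      norm_num
    · simp [hsupp p hp]
  rw [timeIntensity] at hint ⊢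
  rw [integral_prod _ hint]
  simp only [integral_cexp_shell_sub_one ha hu]
  rw [integral_complex_ofReal, integral_neg]

/-- Two nested dominated convergences: in `x` under `1 - cos(h(s) x)`, in `s` under the resulting
`C₀ |h(s)|^(3/2)`, which is bounded with bounded support. -/
lemma tendsto_integral_shell (ha : 0 ≤ a) {h : ℝ → ℝ}
    (hh : Measurable h) {M T : ℝ} (hM : ∀ s, |h s| ≤ M) (hT : ∀ s ∉ Icc 0 T, h s = 0) :
    Tendsto (fun n : ℕ => ∫ s in Ici (0 : ℝ), ∫ x in shell (1 / ((n : ℝ) + 1)) (n + 1),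
        (1 - Real.cos (h s * x)) ∂(jumpMeasure a)) atTop
      (𝓝 (∫ s in Ici 0, C₀ a * |h s| ^ (3 / 2 : ℝ))) := by
  have hM0 : 0 ≤ M := (abs_nonneg _).trans (hM 0)
  have hnonneg : ∀ y : ℝ, 0 ≤ 1 - Real.cos y := fun y => by linarith [Real.cos_le_one y]
  have hle : ∀ (n : ℕ) (y : ℝ), ∫ x in shell (1 / ((n : ℝ) + 1)) (n + 1),
      (1 - Real.cos (y * x)) ∂(jumpMeasure a) ≤ C₀ a * |y| ^ (3 / 2 : ℝ) := by
    intro n y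
    rw [← integral_one_sub_cos ha]
    exact setIntegral_le_integral (integrable_one_sub_cos ha y) (ae_of_all _ fun x => hnonneg _)
  refine tendsto_integral_of_dominated_convergence (fun s => C₀ a * |h s| ^ (3 / 2 : ℝ))
    (fun n => ?_) ?_ (fun n => ae_of_all _ fun s => ?_) (ae_of_all _ fun s => ?_)
  · have : StronglyMeasurable fun p : ℝ × ℝ => 1 - Real.cos (h p.1 * p.2) := by
      have : Measurable fun p : ℝ × ℝ => 1 - Real.cos (h p.1 * p.2) := by fun_prop
      exact this.stronglyMeasurable
    exact this.integral_prod_right.aestronglyMeasurable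
  · refine Integrable.integrableOn ?_
    refine integrable_of_bounded_of_support (B := Icc 0 T)
      (M := C₀ a * M ^ (3 / 2 : ℝ))
      ((hh.abs.pow_const _).const_mul _).aestronglyMeasurable (fun s => ?_) (by simp)
      (fun s hs => by simp [hT s hs, Real.zero_rpow])
    have hC : 0 ≤ C₀ a := by
      have := integral_one_sub_cos ha 1
      rw [abs_one, Real.one_rpow, mul_one] at this
      rw [← this]
      exact integral_nonneg fun x => hnonneg _
    rw [Real.norm_of_nonneg (by positivity)]
    have := hM s
    gcongr
  · rw [Real.norm_of_nonneg (integral_nonneg fun x => hnonneg _)]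
    exact hle n (h s)
  · rw [← integral_one_sub_cos ha]
    have hint := integrable_one_sub_cos ha (h s)
    simp_rw [← integral_indicator (measurableSet_shell _ _)]
    refine tendsto_integral_of_dominated_convergence (fun x => 1 - Real.cos (h s * x))
      (fun n => hint.aestronglyMeasurable.indicator (measurableSet_shell _ _)) hint
      (fun n => ae_of_all _ fun x => ?_) (ae_of_all _ fun x => ?_)
    · refine (norm_indicator_le_norm_self _ _).trans ?_
      rw [Real.norm_of_nonneg (hnonneg _)]
    -- The point `0` lies in no shell, but the integrand vanishes there.
    · rcases eq_or_ne x 0 with rfl | hx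
      · simp [indicator]
      refine tendsto_const_nhds.congr' ?_
      obtain ⟨N, hN⟩ := exists_nat_ge |x|
      obtain ⟨N', hN'⟩ := exists_nat_ge (1 / |x|)
      filter_upwards [eventually_ge_atTop (max N N')] with n hn
      have hn1 : (N : ℝ) ≤ n := by exact_mod_cast (le_max_left _ _).trans hn
      have hn2 : (N' : ℝ) ≤ n := by exact_mod_cast (le_max_right _ _).trans hn
      rw [indicator_of_mem]
      refine ⟨?_, by linarith⟩
      rw [div_lt_iff₀ (by positivity), ← div_lt_iff₀' (abs_pos.2 hx)]
      linarith

/-- The sum of the jumps with modulus in `(1/(n+1), n+1]` converges to the sum of all jumps. -/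
lemma TameJumps.tendsto_setIntegral_shell {μ : Measure (ℝ × ℝ)} (ht : TameJumps μ)
    (hc : UniformCauchyJumps μ) (θ : ℝ≥0) :
    Tendsto (fun n : ℕ => ∫ p in Icc 0 (θ : ℝ) ×ˢ shell (1 / ((n : ℝ) + 1)) (n + 1), p.2 ∂μ)
      atTop (𝓝 (jumpLim μ θ)) := by
  have h1 : Tendsto (fun n : ℕ => jumpSum μ (1 / ((n : ℝ) + 1)) θ) atTop (𝓝 (jumpLim μ θ)) :=
    (hc.tendsto θ).comp (tendsto_nhdsWithin_iff.2 ⟨tendsto_one_div_add_atTop_nhds_zero_nat,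
      Eventually.of_forall fun n => by simp only [mem_Ioi]; positivity⟩)
  -- The upper cut-off `n + 1` only serves to keep integrands bounded; the jumps beyond it disappear
  -- because their sets decrease to the empty set.
  have h2 : Tendsto (fun n : ℕ => jumpSum μ ((n : ℝ) + 1) θ) atTop (𝓝 0) := by
    have := tendsto_setIntegral_of_antitone (μ := μ) (f := fun p : ℝ × ℝ => p.2)
      (s := fun n : ℕ => Icc 0 (θ : ℝ) ×ˢ bigJumps ((n : ℝ) + 1))
      (fun n => measurableSet_Icc.prod (measurableSet_bigJumps _))
      (fun m n hmn => prod_mono subset_rfl fun x hx => by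
        have : (m : ℝ) ≤ n := by exact_mod_cast hmn
        exact lt_of_le_of_lt (by linarith : (m : ℝ) + 1 ≤ n + 1) hx)
      ⟨0, ht.integrableOn _ (by positivity) _⟩
    have hempty : ⋂ n : ℕ, Icc 0 (θ : ℝ) ×ˢ bigJumps ((n : ℝ) + 1) = ∅ := by
      refine eq_empty_of_forall_notMem fun p hp => ?_
      obtain ⟨n, hn⟩ := exists_nat_ge |p.2|
      have h3 : (n : ℝ) + 1 < |p.2| := (mem_iInter.1 hp n).2
      linarith
    rwa [hempty, setIntegral_empty] at this
  have h3 := h1.sub h2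
  rw [sub_zero] at h3
  refine h3.congr fun n => ht.jumpSum_sub (by positivity) ?_ _
  rw [div_le_iff₀ (by positivity)]
  have : (0 : ℝ) ≤ n := Nat.cast_nonneg n
  nlinarith

/-- The step function `∑ⱼ lⱼ 1_{[0, tⱼ]}`. -/
def stepFun {ι : Type*} [Fintype ι] (l : ι → ℝ) (t : ι → ℝ≥0) (s : ℝ) : ℝ :=
  ∑ j, (Icc 0 (t j : ℝ)).indicator (fun _ => l j) s

lemma measurable_stepFun {ι : Type*} [Fintype ι] (l : ι → ℝ) (t : ι → ℝ≥0) :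
    Measurable (stepFun l t) :=
  Finset.measurable_sum _ fun _ _ => measurable_const.indicator measurableSet_Icc

lemma abs_stepFun_le {ι : Type*} [Fintype ι] (l : ι → ℝ) (t : ι → ℝ≥0) (s : ℝ) :
    |stepFun l t s| ≤ ∑ j, |l j| :=
  (Finset.abs_sum_le_sum_abs _ _).trans <| Finset.sum_le_sum fun j _ => by
    by_cases hs : s ∈ Icc 0 (t j : ℝ)
    · rw [indicator_of_mem hs]
    · rw [indicator_of_notMem hs, abs_zero]; exact abs_nonneg _

lemma stepFun_eq_zero {ι : Type*} [Fintype ι] (l : ι → ℝ) (t : ι → ℝ≥0) (s : ℝ)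
    (hs : s ∉ Icc 0 (∑ j, t j : ℝ)) : stepFun l t s = 0 := by
  refine Finset.sum_eq_zero fun j _ => indicator_of_notMem (fun hsj => hs ⟨hsj.1, ?_⟩) _
  exact hsj.2.trans (Finset.single_le_sum (f := fun j => (t j : ℝ))
    (fun i _ => (t i).2) (Finset.mem_univ j))

lemma TameJumps.integral_stepFun_mul {ι : Type*} [Fintype ι] (l : ι → ℝ) (t : ι → ℝ≥0)
    {μ : Measure (ℝ × ℝ)} (ht : TameJumps μ) {u : ℝ} (hu : 0 < u) (v : ℝ) :
    ∫ p : ℝ × ℝ, stepFun l t p.1 * (shell u v).indicator id p.2 ∂μ =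
      ∑ j, l j * ∫ p in Icc 0 (t j : ℝ) ×ˢ shell u v, p.2 ∂μ := by
  have hm : ∀ j, MeasurableSet (Icc 0 (t j : ℝ) ×ˢ shell u v) := fun j =>
    measurableSet_Icc.prod (measurableSet_shell u v)
  have heq : ∀ p : ℝ × ℝ, stepFun l t p.1 * (shell u v).indicator id p.2 =
      ∑ j, l j * (Icc 0 (t j : ℝ) ×ˢ shell u v).indicator (fun p : ℝ × ℝ => p.2) p := by
    intro p
    rw [stepFun, Finset.sum_mul]
    refine Finset.sum_congr rfl fun j _ => ?_
    by_cases h1 : p.1 ∈ Icc 0 (t j : ℝ) <;> by_cases h2 : p.2 ∈ shell u v <;>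
      simp [indicator, h1, h2, -mem_Icc]
  simp_rw [heq]
  rw [integral_finsetSum _ fun j _ => ((integrable_indicator_iff (hm j)).2
    (ht.integrableOn_shell hu v subset_rfl)).const_mul _]
  simp_rw [integral_const_mul, integral_indicator (hm _)]

/-- The joint characteristic function of the values of the process of jumps. -/
lemma HasPoissonLaplace.charFunctional [IsProbabilityMeasure P]
    (hR : HasPoissonLaplace R (timeIntensity (jumpMeasure a)) P) (ha : 0 ≤ a)
    (htame : ∀ᵐ ω ∂P, TameJumps (R ω)) (hcauchy : ∀ᵐ ω ∂P, UniformCauchyJumps (R ω)) {ι : Type*} [Fintype ι] (l : ι → ℝ) (t : ι → ℝ≥0) :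
    AEMeasurable (fun ω => ∑ j, l j * jumpLim (R ω) (t j)) P ∧
    ∫ ω, Complex.exp (((∑ j, l j * jumpLim (R ω) (t j) : ℝ) : ℂ) * Complex.I) ∂P =
      Complex.exp ((-∫ s in Ici 0, C₀ a * |stepFun l t s| ^ (3 / 2 : ℝ) : ℝ) : ℂ) := by
  have hn : ∀ n : ℕ, (0 : ℝ) < 1 / ((n : ℝ) + 1) := fun n => by positivity
  have hW := fun n : ℕ => hR.integral_cexp_shell ha (measurable_stepFun l t) (abs_stepFun_le l t)
    (stepFun_eq_zero l t) (hn n) (v := (n : ℝ) + 1) (by positivity)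
  have hlim : ∀ᵐ ω ∂P, Tendsto (fun n : ℕ => ∫ p : ℝ × ℝ, stepFun l t p.1 *
      (shell (1 / ((n : ℝ) + 1)) ((n : ℝ) + 1)).indicator id p.2 ∂(R ω)) atTop
      (𝓝 (∑ j, l j * jumpLim (R ω) (t j))) := by
    filter_upwards [htame, hcauchy] with ω h1 h2
    simp_rw [h1.integral_stepFun_mul l t (hn _)]
    exact tendsto_finsetSum _ fun j _ => (h1.tendsto_setIntegral_shell h2 (t j)).const_mul _
  refine ⟨aemeasurable_of_tendsto_metrizable_ae atTop (fun n => (hW n).1.aemeasurable) hlim, ?_⟩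
  have hcont : Continuous fun y : ℝ => Complex.exp ((y : ℂ) * Complex.I) := by fun_prop
  have hL := tendsto_integral_of_dominated_convergence (fun _ => (1 : ℝ))
    (fun n => hcont.comp_aestronglyMeasurable (hW n).1) (integrable_const (μ := P) 1)
    (fun n => ae_of_all _ fun ω => (Complex.norm_exp_ofReal_mul_I _).le)
    (hlim.mono fun ω hω => (hcont.tendsto _).comp hω)
  simp only [(hW _).2] at hL
  refine tendsto_nhds_unique hL ?_
  refine (Complex.continuous_exp.tendsto _).comp ((Complex.continuous_ofReal.tendsto _).comp ?_)
  exact (tendsto_integral_shell ha (measurable_stepFun l t) (abs_stepFun_le l t)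
    (stepFun_eq_zero l t)).neg

end CharacteristicFunctional

end

/-! ### Lévy, symmetry and stability properties from characteristic functions. -/

section FiniteDimensional

variable {Ω : Type*} [MeasurableSpace Ω] {P : Measure Ω}

lemma charFunDual_map_pi {ι : Type*} [Fintype ι] [DecidableEq ι] {A : ι → Ω → ℝ}
    (hA : ∀ i, AEMeasurable (A i) P) (L : StrongDual ℝ (ι → ℝ)) :
    charFunDual (P.map fun ω i => A i ω) L =
      ∫ ω, Complex.exp (((∑ i, L (Pi.single i 1) * A i ω : ℝ) : ℂ) * Complex.I) ∂P := by
  rw [charFunDual_apply, integral_map (aemeasurable_pi_lambda _ hA) (by fun_prop)]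
  refine integral_congr_ae (ae_of_all _ fun ω => ?_)
  simp only
  have hsingle : ∀ i : ι, (fun j => if i = j then (1 : ℝ) else 0) = Pi.single i 1 := fun i => by
    ext j; simp [Pi.single_apply, eq_comm]
  rw [← ContinuousLinearMap.coe_coe L, LinearMap.pi_apply_eq_sum_univ]
  simp only [hsingle, smul_eq_mul, mul_comm]

lemma identDistrib_pi_of_charFun [IsProbabilityMeasure P] {ι : Type*} [Fintype ι] {A B : ι → Ω → ℝ}
    (hA : ∀ i, AEMeasurable (A i) P) (hB : ∀ i, AEMeasurable (B i) P)
    (h : ∀ l : ι → ℝ, ∫ ω, Complex.exp (((∑ i, l i * A i ω : ℝ) : ℂ) * Complex.I) ∂P =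
      ∫ ω, Complex.exp (((∑ i, l i * B i ω : ℝ) : ℂ) * Complex.I) ∂P) :
    IdentDistrib (fun ω i => A i ω) (fun ω i => B i ω) P P := by
  classical
  have hA' := aemeasurable_pi_lambda _ hA
  have hB' := aemeasurable_pi_lambda _ hB
  refine ⟨hA', hB', ?_⟩
  have := Measure.isProbabilityMeasure_map hA'
  have := Measure.isProbabilityMeasure_map hB'
  refine Measure.ext_of_charFunDual (funext fun L => ?_)
  rw [charFunDual_map_pi hA, charFunDual_map_pi hB]
  exact h _

lemma identDistrib_of_charFun [IsProbabilityMeasure P] {A B : Ω → ℝ} (hA : AEMeasurable A P) (hB : AEMeasurable B P)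
    (h : ∀ l : ℝ, ∫ ω, Complex.exp (((l * A ω : ℝ) : ℂ) * Complex.I) ∂P =
      ∫ ω, Complex.exp (((l * B ω : ℝ) : ℂ) * Complex.I) ∂P) :
    IdentDistrib A B P P := by
  have := identDistrib_pi_of_charFun (ι := Unit) (A := fun _ => A) (B := fun _ => B)
    (fun _ => hA) (fun _ => hB) (fun l => by simpa using! h (l ()))
  exact this.comp (measurable_pi_apply ())

lemma iIndepFun_of_charFun [IsProbabilityMeasure P] {ι : Type*} [Fintype ι] {A : ι → Ω → ℝ}
    (hA : ∀ i, AEMeasurable (A i) P)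
    (h : ∀ l : ι → ℝ, ∫ ω, Complex.exp (((∑ i, l i * A i ω : ℝ) : ℂ) * Complex.I) ∂P =
      ∏ i, ∫ ω, Complex.exp (((l i * A i ω : ℝ) : ℂ) * Complex.I) ∂P) : iIndepFun A P := by
  classical
  refine (iIndepFun_iff_charFunDual_pi hA).2 fun L => ?_
  rw [charFunDual_map_pi hA, h]
  refine Finset.prod_congr rfl fun i _ => ?_
  rw [charFunDual_apply, integral_map (hA i) (by fun_prop)]
  refine integral_congr_ae (ae_of_all _ fun ω => ?_)
  simp only [ContinuousLinearMap.comp_apply, ContinuousLinearMap.single_apply]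
  have : (Pi.single i (A i ω) : ι → ℝ) = A i ω • Pi.single i 1 := by
    rw [← Pi.single_smul, smul_eq_mul, mul_one]
  rw [this, map_smul, smul_eq_mul, mul_comm (A i ω)]

/-- The finite-dimensional characteristic functions of a symmetric stable process of index
`3/2`. -/
structure HasStableCharFun (X : ℝ≥0 → Ω → ℝ) (C : ℝ) (P : Measure Ω) : Prop where
  aemeasurable : ∀ t, AEMeasurable (X t) P
  integral_cexp : ∀ {ι : Type} [Fintype ι] (l : ι → ℝ) (t : ι → ℝ≥0),
    ∫ ω, Complex.exp (((∑ j, l j * X (t j) ω : ℝ) : ℂ) * Complex.I) ∂P =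
      Complex.exp ((-∫ s in Ici 0, C * |stepFun l t s| ^ (3 / 2 : ℝ) : ℝ) : ℂ)

variable {X : ℝ≥0 → Ω → ℝ} {C : ℝ}

lemma stepFun_neg {ι : Type*} [Fintype ι] (l : ι → ℝ) (t : ι → ℝ≥0) (s : ℝ) :
    stepFun (fun j => -l j) t s = -stepFun l t s := by
  rw [stepFun, stepFun, ← Finset.sum_neg_distrib]
  exact Finset.sum_congr rfl fun j _ => by
    simp only [indicator]; split_ifs <;> simp

lemma stepFun_const_mul {ι : Type*} [Fintype ι] (κ : ℝ) (l : ι → ℝ) (t : ι → ℝ≥0) (s : ℝ) :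
    stepFun (fun j => κ * l j) t s = κ * stepFun l t s := by
  rw [stepFun, stepFun, Finset.mul_sum]
  exact Finset.sum_congr rfl fun j _ => by simp [indicator]

lemma stepFun_time_scaling {ι : Type*} [Fintype ι] (l : ι → ℝ) (t : ι → ℝ≥0) {b : ℝ≥0}
    (hb : 0 < b) (s : ℝ) : stepFun l (fun j => b * t j) s = stepFun l t ((b : ℝ)⁻¹ * s) := by
  have hb' : (0 : ℝ) < b := hb
  refine Finset.sum_congr rfl fun j _ => ?_
  have : s ∈ Icc 0 ((b * t j : ℝ≥0) : ℝ) ↔ (b : ℝ)⁻¹ * s ∈ Icc 0 (t j : ℝ) := by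
    simp only [mem_Icc, NNReal.coe_mul]
    rw [inv_mul_le_iff₀ hb', mul_nonneg_iff_of_pos_left (inv_pos.2 hb')]
  by_cases h : s ∈ Icc 0 ((b * t j : ℝ≥0) : ℝ)
  · rw [indicator_of_mem h, indicator_of_mem (this.1 h)]
  · rw [indicator_of_notMem h, indicator_of_notMem (mt this.2 h)]

/-- Encodes increments: doubling the index set puts weight `l i` at `t₁ i` and `-l i` at `t₀ i`, and
the two closed intervals subtract to a half-open one. -/
lemma stepFun_sumElim {ι : Type*} [Fintype ι] (l : ι → ℝ) {t₀ t₁ : ι → ℝ≥0}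
    (ht : ∀ i, t₀ i ≤ t₁ i) (s : ℝ) :
    stepFun (Sum.elim l fun i => -l i) (Sum.elim t₁ t₀) s =
      ∑ i, (Ioc (t₀ i : ℝ) (t₁ i)).indicator (fun _ => l i) s := by
  rw [stepFun, Fintype.sum_sum_type, ← Finset.sum_add_distrib]
  refine Finset.sum_congr rfl fun i _ => ?_
  have h0 : (0 : ℝ) ≤ t₀ i := (t₀ i).2
  have h1 : (t₀ i : ℝ) ≤ t₁ i := ht i
  simp only [Sum.elim_inl, Sum.elim_inr, indicator, mem_Icc, mem_Ioc]
  split_ifs <;> grind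

/-- At each point at most one term is nonzero, so the nonlinear power acts termwise. This additivity
is what makes increments independent. -/
lemma abs_rpow_sum_indicator {ι : Type*} [Fintype ι] (l : ι → ℝ) {I : ι → Set ℝ}
    (hI : Pairwise fun i j => Disjoint (I i) (I j)) (s : ℝ) :
    |∑ i, (I i).indicator (fun _ => l i) s| ^ (3 / 2 : ℝ) =
      ∑ i, (I i).indicator (fun _ => |l i| ^ (3 / 2 : ℝ)) s := by
  by_cases h : ∃ i, s ∈ I i
  · obtain ⟨i, hi⟩ := h
    have hne : ∀ j, j ≠ i → s ∉ I j := fun j hj hs => disjoint_left.1 (hI hj) hs hi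
    rw [Finset.sum_eq_single i (fun j _ hj => indicator_of_notMem (hne j hj) _) (by simp),
      Finset.sum_eq_single i (fun j _ hj => indicator_of_notMem (hne j hj) _) (by simp),
      indicator_of_mem hi, indicator_of_mem hi]
  · push Not at h
    rw [Finset.sum_eq_zero fun i _ => indicator_of_notMem (h i) _,
      Finset.sum_eq_zero fun i _ => indicator_of_notMem (h i) _, abs_zero,
      Real.zero_rpow (by norm_num)]

lemma HasStableCharFun.integral_cexp_increments (hX : HasStableCharFun X C P) {ι : Type}
    [Fintype ι] (l : ι → ℝ) {t₀ t₁ : ι → ℝ≥0} (ht : ∀ i, t₀ i ≤ t₁ i)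
    (hdisj : Pairwise fun i j => Disjoint (Ioc (t₀ i : ℝ) (t₁ i)) (Ioc (t₀ j : ℝ) (t₁ j))) :
    ∫ ω, Complex.exp (((∑ i, l i * (X (t₁ i) ω - X (t₀ i) ω) : ℝ) : ℂ) * Complex.I) ∂P =
      Complex.exp ((-∑ i, C * ((t₁ i - t₀ i) * |l i| ^ (3 / 2 : ℝ)) : ℝ) : ℂ) := by
  have h := hX.integral_cexp (Sum.elim l fun i => -l i) (Sum.elim t₁ t₀)
  simp only [Fintype.sum_sum_type, Sum.elim_inl, Sum.elim_inr, ← Finset.sum_add_distrib,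
    stepFun_sumElim l ht, abs_rpow_sum_indicator l hdisj] at h
  have e1 : ∀ ω i, l i * X (t₁ i) ω + -l i * X (t₀ i) ω = l i * (X (t₁ i) ω - X (t₀ i) ω) :=
    fun ω i => by ring
  simp_rw [e1] at h
  rw [h, integral_const_mul, integral_finsetSum, Finset.mul_sum]
  · congr 3
    refine Finset.sum_congr rfl fun i _ => ?_
    have hsub : Ici (0 : ℝ) ∩ Ioc (t₀ i : ℝ) (t₁ i) = Ioc (t₀ i : ℝ) (t₁ i) :=
      inter_eq_right.2 fun x hx => (t₀ i).2.trans hx.1.le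
    have hle : (t₀ i : ℝ) ≤ t₁ i := ht i
    rw [setIntegral_indicator measurableSet_Ioc, hsub, setIntegral_const, smul_eq_mul,
      Real.volume_real_Ioc_of_le hle]
  · intro i _
    exact ((integrable_indicator_iff measurableSet_Ioc).2
      (integrableOn_const (by simp))).integrableOn

lemma HasStableCharFun.integral_cexp_increment (hX : HasStableCharFun X C P) (l : ℝ) {s t : ℝ≥0}
    (hst : s ≤ t) :
    ∫ ω, Complex.exp (((l * (X t ω - X s ω) : ℝ) : ℂ) * Complex.I) ∂P =
      Complex.exp ((-(C * ((t - s) * |l| ^ (3 / 2 : ℝ))) : ℝ) : ℂ) := by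
  have := hX.integral_cexp_increments (ι := Unit) (fun _ => l) (t₀ := fun _ => s)
    (t₁ := fun _ => t) (fun _ => hst) (Subsingleton.pairwise)
  simpa using! this

variable [IsProbabilityMeasure P]

/-- The step function for time `0` lives on the null set `{0}`, so `X 0` has characteristic function
`1`, that of the constant `0`. -/
lemma HasStableCharFun.zero (hX : HasStableCharFun X C P) : ∀ᵐ ω ∂P, X 0 ω = 0 := by
  have h : IdentDistrib (X 0) (fun _ => (0 : ℝ)) P P := by
    refine identDistrib_of_charFun (hX.aemeasurable 0) aemeasurable_const fun l => ?_
    have h1 := hX.integral_cexp (ι := Unit) (fun _ => l) (fun _ => 0)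
    have h2 : ∫ s in Ici (0 : ℝ), C * |stepFun (fun _ : Unit => l) (fun _ => 0) s| ^ (3 / 2 : ℝ)
        = 0 := by
      refine integral_eq_zero_of_ae (ae_restrict_of_ae ?_)
      filter_upwards [compl_mem_ae_iff.2 (measure_singleton (0 : ℝ))] with s hs
      have hs' : s ≠ 0 := hs
      simp [stepFun, hs', Real.zero_rpow]
    rw [h2] at h1
    simpa using! h1
  exact h.symm.ae_snd (p := fun x => x = 0) (measurableSet_singleton 0) (ae_of_all _ fun _ => rfl)

lemma HasStableCharFun.integral_cexp_single (hX : HasStableCharFun X C P) (l : ℝ) (t : ℝ≥0) :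
    ∫ ω, Complex.exp (((l * X t ω : ℝ) : ℂ) * Complex.I) ∂P =
      Complex.exp ((-(C * (t * |l| ^ (3 / 2 : ℝ))) : ℝ) : ℂ) := by
  have h := hX.integral_cexp_increment l (zero_le : 0 ≤ t)
  rw [NNReal.coe_zero, sub_zero] at h
  rw [← h]
  refine integral_congr_ae ?_
  filter_upwards [hX.zero] with ω hω
  rw [hω, sub_zero]

lemma HasStableCharFun.hasCharExponent (hX : HasStableCharFun X C P) :
    HasCharExponent X (fun l : ℝ => ((C * |l| ^ (3 / 2 : ℝ) : ℝ) : ℂ)) P := by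
  intro t l
  have h := hX.integral_cexp_single l t
  have e : ∀ ω, Complex.I * (l : ℂ) * (X t ω : ℂ) = ((l * X t ω : ℝ) : ℂ) * Complex.I := by
    intro ω; push_cast; ring
  simp_rw [e]
  rw [h]
  congr 1
  push_cast
  ring

lemma HasStableCharFun.hasIndepIncrements (hX : HasStableCharFun X C P) :
    HasIndepIncrements X P := by
  intro n t ht
  have hle : ∀ i : Fin n, t i.castSucc ≤ t i.succ := fun i => ht (Fin.castSucc_lt_succ).le
  have hdisj : Pairwise fun i j : Fin n =>
      Disjoint (Ioc (t i.castSucc : ℝ) (t i.succ)) (Ioc (t j.castSucc : ℝ) (t j.succ)) := by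
    have key : ∀ i j : Fin n, i < j →
        Disjoint (Ioc (t i.castSucc : ℝ) (t i.succ)) (Ioc (t j.castSucc : ℝ) (t j.succ)) := by
      intro i j hij
      refine disjoint_left.2 fun x hx hx' => ?_
      have h1 : (t i.succ : ℝ) ≤ t j.castSucc := ht (by
        rw [Fin.le_def, Fin.val_succ, Fin.val_castSucc]; exact hij)
      linarith [hx.2, hx'.1]
    intro i j hij
    rcases lt_or_gt_of_ne hij with h | h
    · exact key i j h
    · exact (key j i h).symm
  refine iIndepFun_of_charFun (fun i => (hX.aemeasurable _).sub (hX.aemeasurable _)) fun l => ?_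
  rw [hX.integral_cexp_increments l hle hdisj]
  simp_rw [hX.integral_cexp_increment _ (hle _)]
  rw [← Complex.exp_sum]
  push_cast
  rw [Finset.sum_neg_distrib]

lemma HasStableCharFun.isLevyProcess (hX : HasStableCharFun X C P)
    (hcadlag : ∀ᵐ ω ∂P, IsCadlag fun t => X t ω) : IsLevyProcess X P where
  aemeasurable := hX.aemeasurable
  zero := hX.zero
  indep_increments := hX.hasIndepIncrements
  stationary_increments s t := by
    refine identDistrib_of_charFun ((hX.aemeasurable _).sub (hX.aemeasurable _))
      (hX.aemeasurable t) fun l => ?_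
    rw [hX.integral_cexp_increment l (le_add_of_nonneg_right zero_le),
      hX.integral_cexp_single]
    simp
  cadlag := hcadlag

lemma HasStableCharFun.isSymmetricProcess (hX : HasStableCharFun X C P) :
    IsSymmetricProcess X P := by
  intro I
  refine identDistrib_pi_of_charFun (fun i => hX.aemeasurable _)
    (fun i => (hX.aemeasurable _).neg) fun l => ?_
  have h1 := hX.integral_cexp l (fun i : I => (i : ℝ≥0))
  have h2 := hX.integral_cexp (fun i => -l i) (fun i : I => (i : ℝ≥0))
  simp only [stepFun_neg, abs_neg, neg_mul] at h2
  simp only [mul_neg]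
  rw [h1, h2]

lemma HasStableCharFun.isStableProcess (hX : HasStableCharFun X C P) (hC : 0 < C) :
    IsStableProcess (3 / 2) X P where
  index_pos := by norm_num
  scaling b hb I := by
    have hb' : (0 : ℝ) < b := hb
    refine identDistrib_pi_of_charFun (fun i => hX.aemeasurable _)
      (fun i => (hX.aemeasurable _).const_mul _) fun l => ?_
    have h1 := hX.integral_cexp l (fun i : I => b * (i : ℝ≥0))
    have h2 := hX.integral_cexp (fun i => (b : ℝ) ^ (1 / (3 / 2) : ℝ) * l i)
      (fun i : I => (i : ℝ≥0))
    have e : ∀ ω (i : I), (b : ℝ) ^ (1 / (3 / 2) : ℝ) * l i * X i ω =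
        l i * ((b : ℝ) ^ (1 / (3 / 2) : ℝ) * X i ω) := fun ω i => by ring
    -- The factor `b` obtained here matches the Jacobian of the substitution `s ↦ b⁻¹ s` on the
    -- other side.
    have hpow : ((b : ℝ) ^ (1 / (3 / 2) : ℝ)) ^ (3 / 2 : ℝ) = b := by
      rw [← Real.rpow_mul hb'.le]; norm_num
    simp_rw [e, stepFun_const_mul, abs_mul, Real.mul_rpow (abs_nonneg _) (abs_nonneg _),
      abs_of_nonneg (Real.rpow_nonneg hb'.le _), hpow] at h2
    rw [h1, h2]
    congr 3
    simp_rw [stepFun_time_scaling l _ hb]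
    rw [integral_Ici_eq_integral_Ioi, integral_Ici_eq_integral_Ioi,
      integral_comp_mul_left_Ioi
        (fun s => C * |stepFun l (fun i : I => (i : ℝ≥0)) s| ^ (3 / 2 : ℝ)) 0 (inv_pos.2 hb'),
      mul_zero, inv_inv, smul_eq_mul, ← integral_const_mul]
    refine integral_congr_ae (ae_of_all _ fun s => ?_)
    ring
  nondegenerate := by
    refine ⟨1, fun x hx => ?_⟩
    have h := hX.integral_cexp_single 1 1
    -- A constant has a characteristic function of modulus `1`, whereas that of `X 1` at `1` is
    -- `exp(-C) < 1`.
    have h2 : ∫ ω, Complex.exp (((1 * X 1 ω : ℝ) : ℂ) * Complex.I) ∂P =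
        Complex.exp ((x : ℂ) * Complex.I) := by
      rw [integral_congr_ae (g := fun _ => Complex.exp ((x : ℂ) * Complex.I))
        (by filter_upwards [hx] with ω hω; rw [hω, one_mul])]
      simp
    rw [h2] at h
    have h3 := congrArg norm h
    rw [Complex.norm_exp_ofReal_mul_I, Complex.norm_exp, Complex.ofReal_re] at h3
    have h4 : Real.exp (-(C * (((1 : ℝ≥0) : ℝ) * |(1 : ℝ)| ^ (3 / 2 : ℝ)))) < 1 := by
      rw [Real.exp_lt_one_iff]
      simpa using hC
    exact absurd h3 h4.ne'

end FiniteDimensional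

end PoissonStable

/-! ### Assembly of the theorem. -/

theorem mainTheorem4 {Ω : Type*} [MeasurableSpace Ω] (P : Measure Ω) [IsProbabilityMeasure P]
    (a : ℝ) (ha : 0 < a) (Rp Rm : Ω → Measure (ℝ × ℝ))
    (hRp : PoissonStable.IsPoissonPointProcess Rp
      (PoissonStable.timeIntensity (PoissonStable.nuPlus a)) P)
    (hRm : PoissonStable.IsPoissonPointProcess Rm
      (PoissonStable.timeIntensity (PoissonStable.nuMinus a)) P)
    (hindep : IndepFun Rp Rm P) :
    -- almost surely, every truncation is a finite (absolutely convergent) sum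
    (∀ᵐ ω ∂P, ∀ c : ℝ, 0 < c → ∀ θ : ℝ≥0,
      Rp ω (Icc (0 : ℝ) θ ×ˢ Ioi c) < ∞ ∧ Rm ω (Icc (0 : ℝ) θ ×ˢ Iio (-c)) < ∞ ∧
      IntegrableOn (fun p : ℝ × ℝ => p.2) (Icc (0 : ℝ) θ ×ˢ Ioi c) (Rp ω) ∧
      IntegrableOn (fun p : ℝ × ℝ => p.2) (Icc (0 : ℝ) θ ×ˢ Iio (-c)) (Rm ω)) ∧
    -- almost surely, the limit defining `V` exists at all times
    (∀ᵐ ω ∂P, ∀ θ : ℝ≥0, ∃ v : ℝ,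
      Tendsto (fun c : ℝ => PoissonStable.truncV Rp Rm c θ ω) (𝓝[>] 0) (𝓝 v)) ∧
    -- `V` is a symmetric Lévy process, stable of index `3/2`
    PoissonStable.IsLevyProcess (PoissonStable.V Rp Rm) P ∧
    PoissonStable.IsSymmetricProcess (PoissonStable.V Rp Rm) P ∧
    PoissonStable.IsStableProcess (3 / 2) (PoissonStable.V Rp Rm) P ∧
    -- its characteristic exponent is `C₀ |l|^{3/2}`, with `C₀` a finite positive constant
    Integrable (fun y : ℝ => |y| ^ (-(5 / 2) : ℝ) * (1 - Real.cos y)) ∧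
    0 < PoissonStable.C₀ a ∧
    PoissonStable.HasCharExponent (PoissonStable.V Rp Rm)
      (fun l : ℝ => ((PoissonStable.C₀ a * |l| ^ (3 / 2 : ℝ) : ℝ) : ℂ)) P ∧
    -- almost surely, the truncations converge to `V` uniformly on compact time intervals
    (∀ᵐ ω ∂P, ∀ T : ℝ≥0,
      TendstoUniformlyOn (fun (c : ℝ) (θ : ℝ≥0) => PoissonStable.truncV Rp Rm c θ ω)
        (fun θ => PoissonStable.V Rp Rm θ ω) (𝓝[>] 0) (Icc 0 T)) := by
  have h : ∀ᵐ ω ∂P, PoissonStable.TamePair (Rp ω) (Rm ω) := PoissonStable.ae_tamePair hRp hRm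
  have hR : PoissonStable.HasPoissonLaplace (fun ω => Rp ω + Rm ω)
      (PoissonStable.timeIntensity (PoissonStable.jumpMeasure a)) P := by
    rw [← PoissonStable.timeIntensity_add]
    exact hRp.hasPoissonLaplace.add hRm.hasPoissonLaplace hindep
  have htame : ∀ᵐ ω ∂P, PoissonStable.TameJumps (Rp ω + Rm ω) :=
    h.mono fun ω hω => hω.tame_left.add hω.tame_right
  -- Integer horizons keep the union of null sets countable; the horizon `T + 1` is positive even
  -- for `T = 0`.
  have hcauchy : ∀ᵐ ω ∂P, PoissonStable.UniformCauchyJumps (Rp ω + Rm ω) :=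
    ae_all_iff.2 fun T => hR.ae_uniformCauchy ha.le htame (by positivity : (0 : ℝ) < T + 1)
  have hV : ∀ᵐ ω ∂P, ∀ θ : ℝ≥0,
      PoissonStable.V Rp Rm θ ω = PoissonStable.jumpLim (Rp ω + Rm ω) θ :=
    h.mono fun ω hω θ => hω.V_eq θ
  -- Almost surely `V` equals `jumpLim (Rp ω + Rm ω)` at all times, so measurability and the joint
  -- characteristic functions transfer from the superposition.
  have hX : PoissonStable.HasStableCharFun (PoissonStable.V Rp Rm) (PoissonStable.C₀ a) P := by
    refine ⟨fun t => ?_, fun l t => ?_⟩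
    · have := (hR.charFunctional ha.le htame hcauchy (fun _ : Unit => 1) (fun _ => t)).1
      refine this.congr (hV.mono fun ω hω => ?_)
      simp [hω t]
    · rw [← (hR.charFunctional ha.le htame hcauchy l t).2]
      refine integral_congr_ae (hV.mono fun ω hω => ?_)
      simp only [hω]
  have hC := PoissonStable.C₀_pos ha
  refine ⟨?_, ?_, hX.isLevyProcess ?_, hX.isSymmetricProcess, hX.isStableProcess hC,
    PoissonStable.integrable_abs_rpow_mul_one_sub_cos, hC, hX.hasCharExponent, ?_⟩
  · filter_upwards [h] with ω hω c hc θ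
    have hp : Icc (0 : ℝ) θ ×ˢ Ioi c ⊆ Icc (0 : ℝ) θ ×ˢ PoissonStable.bigJumps c :=
      prod_mono subset_rfl (PoissonStable.Ioi_subset_bigJumps c)
    have hm : Icc (0 : ℝ) θ ×ˢ Iio (-c) ⊆ Icc (0 : ℝ) θ ×ˢ PoissonStable.bigJumps c :=
      prod_mono subset_rfl (PoissonStable.Iio_neg_subset_bigJumps c)
    exact ⟨(measure_mono hp).trans_lt (hω.tame_left.lt_top c hc θ),
      (measure_mono hm).trans_lt (hω.tame_right.lt_top c hc θ),
      (hω.tame_left.integrableOn c hc θ).mono_set hp,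
      (hω.tame_right.integrableOn c hc θ).mono_set hm⟩
  · filter_upwards [h, hcauchy] with ω hω hω' θ
    refine ⟨_, (hω'.tendsto θ).congr' ?_⟩
    filter_upwards [self_mem_nhdsWithin] with c hc
    exact (hω.truncV_eq hc θ).symm
  · filter_upwards [htame, hcauchy, hV] with ω h1 h2 h3
    simp only [h3]
    exact h2.isCadlag h1
  · filter_upwards [h, hcauchy, hV] with ω h1 h2 h3 T
    simp only [h3]
    refine (h2.tendstoUniformlyOn T).congr ?_
    filter_upwards [self_mem_nhdsWithin] with c hc θ _
    exact (h1.truncV_eq hc θ).symm
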